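/- Let $K$ be an algebraically closed field of characteristic $2$ and let $d\ge 2$ be an even integer. For a homogeneous polynomial $B\in K[x_1,x_2,x_3]$ of degree $d$ let $\Sigma=\Sigma_B\subset\mathbb P^2_K$ be its critical scheme, i.e. the closed subscheme defined by the partial derivatives $\partial_1B,\partial_2B,\partial_3B$. The strange points of the curve $\{B=0\}$ are the points of $\Sigma$ that do not lie on the curve. (1) For general $B$ (that is, for all $B$ in a nonempty Zariski open subset of the affine space of homogeneous polynomials of degree $d$), no point of $\Sigma$ lies on the curve $\{B=0\}$, so that $\Sigma$ is the set of strange points, and $\Sigma$ consists of exactly $(d-1)(d-2)+1$ points. (2) For every homogeneous $B$ of degree $d$ such that $\Sigma$ is finite, the length of $\Sigma$, that is $\sum_{p\in\Sigma}\operatorname{length}\,\mathcal O_{\Sigma,p}$, equals $(d-1)(d-2)+1$. -/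

import Mathlib

open MvPolynomial
open scoped LinearAlgebra.Projectivization

noncomputable section

namespace StrangePoints

variable {K : Type*} [Field K]

attribute [local instance] MvPolynomial.gradedAlgebra

/-- A property `Q` holds for a general homogeneous polynomial of degree `d` in three variables:
there is a polynomial `P` in the coefficients which is nonzero at some form of degree `d`, and `Q`
holds for every form of degree `d` at which `P` does not vanish. In other words, `Q` holds on a
nonempty (basic) Zariski open subset of the affine space of forms of degree `d`. -/
def HoldsForGeneral (d : ℕ) (Q : MvPolynomial (Fin 3) K → Prop) : Prop :=
  ∃ P : MvPolynomial (Fin 3 →₀ ℕ) K,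
    (∃ B : MvPolynomial (Fin 3) K, B.IsHomogeneous d ∧ eval (fun m => coeff m B) P ≠ 0) ∧
    ∀ B : MvPolynomial (Fin 3) K, B.IsHomogeneous d → eval (fun m => coeff m B) P ≠ 0 → Q B

/-- The critical locus `Σ = {∇B = 0}`, as a set of points of the projective plane
(for `B` homogeneous the condition does not depend on the representative). -/
def criticalLocus (B : MvPolynomial (Fin 3) K) : Set (ℙ K (Fin 3 → K)) :=
  {p | ∀ i, eval p.rep (pderiv i B) = 0}

/-- The strange points of the plane curve `{B = 0}`: the points outside the curve where the
gradient of `B` vanishes. -/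
def strangePoints (B : MvPolynomial (Fin 3) K) : Set (ℙ K (Fin 3 → K)) :=
  {p | p ∈ criticalLocus B ∧ eval p.rep B ≠ 0}

/-- The ideal `(∂₁B, ∂₂B, ∂₃B)` defining the critical scheme. -/
def gradientIdeal (B : MvPolynomial (Fin 3) K) : Ideal (MvPolynomial (Fin 3) K) :=
  Ideal.span (Set.range fun i => pderiv i B)

/-- The homogeneous ideal of a point `p` of the projective plane: all polynomials vanishing on
the line in `K³` which `p` represents. -/
def pointIdeal (p : ℙ K (Fin 3 → K)) : Ideal (MvPolynomial (Fin 3) K) where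
  carrier := {f | ∀ w ∈ p.submodule, eval w f = 0}
  add_mem' hf hg w hw := by rw [map_add, hf w hw, hg w hw, add_zero]
  zero_mem' w _ := by rw [map_zero]
  smul_mem' c f hf w hw := by rw [smul_eq_mul, map_mul, hf w hw, mul_zero]

theorem mem_pointIdeal {p : ℙ K (Fin 3 → K)} {f : MvPolynomial (Fin 3) K} :
    f ∈ pointIdeal p ↔ ∀ w ∈ p.submodule, eval w f = 0 := Iff.rfl

instance pointIdeal_isPrime [Infinite K] (p : ℙ K (Fin 3 → K)) : (pointIdeal p).IsPrime := by
  let φ : MvPolynomial (Fin 3) K →ₐ[K] Polynomial K :=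
    aeval fun i => Polynomial.C (p.rep i) * Polynomial.X
  have hφ : ∀ (f : MvPolynomial (Fin 3) K) (t : K),
      Polynomial.eval t (φ f) = eval (t • p.rep) f := by
    intro f t
    induction f using MvPolynomial.induction_on with
    | C a => simp [φ]
    | add f g hf hg => simp [hf, hg]
    | mul_X f i hf =>
      have hX : Polynomial.eval t (φ (X i)) = eval (t • p.rep) (X i) := by
        simp only [φ, aeval_X, Polynomial.eval_mul, Polynomial.eval_C, Polynomial.eval_X, eval_X,
          Pi.smul_apply, smul_eq_mul]
        exact mul_comm _ _
      rw [map_mul, map_mul, Polynomial.eval_mul, hf, hX]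
  have h : pointIdeal p = RingHom.ker φ := by
    ext f
    rw [mem_pointIdeal, RingHom.mem_ker]
    constructor
    · intro hf
      refine Polynomial.funext fun t => ?_
      rw [hφ, Polynomial.eval_zero]
      refine hf _ ?_
      rw [p.submodule_eq]
      exact Submodule.smul_mem _ _ (Submodule.mem_span_singleton_self _)
    · intro hf w hw
      rw [p.submodule_eq, Submodule.mem_span_singleton] at hw
      obtain ⟨t, rfl⟩ := hw
      rw [← hφ, hf, Polynomial.eval_zero]
  rw [h]
  exact RingHom.ker_isPrime _

/-- The local ring of the projective plane at `p`: fractions `f / g` of homogeneous polynomials of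
the same degree with `g` not vanishing at `p`. -/
abbrev LocalRingAt [Infinite K] (p : ℙ K (Fin 3 → K)) : Type _ :=
  HomogeneousLocalization.AtPrime (homogeneousSubmodule (Fin 3) K) (pointIdeal p)

/-- The stalk at `p` of the ideal sheaf on the projective plane associated with the homogeneous
ideal `J`: the degree zero part of the localization of `J` at the ideal of `p`. -/
def stalkIdeal [Infinite K] (J : Ideal (MvPolynomial (Fin 3) K)) (p : ℙ K (Fin 3 → K)) :
    Ideal (LocalRingAt p) :=
  (J.map (algebraMap (MvPolynomial (Fin 3) K) (Localization.AtPrime (pointIdeal p)))).comap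
    (algebraMap (LocalRingAt p) (Localization.AtPrime (pointIdeal p)))

/-- The length of the critical scheme `Σ` (meaningful when `Σ` is finite): the sum over its points
`p` of the length of the local ring `𝒪_{Σ,p} = 𝒪_{ℙ²,p} / (∂₁B, ∂₂B, ∂₃B)`. -/
def criticalLength [Infinite K] (B : MvPolynomial (Fin 3) K) : ℕ∞ :=
  ∑ᶠ p ∈ criticalLocus B,
    Module.length (LocalRingAt p) (LocalRingAt p ⧸ stalkIdeal (gradientIdeal B) p)

end StrangePoints

end

noncomputable section

namespace StrangePoints

attribute [local instance] MvPolynomial.gradedAlgebra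

/-! ### Homogeneous components and the Nullstellensatz -/

section General

variable {σ R : Type*} [CommRing R]

/-! Let `P` be the triple of mixed second derivatives of `B` and `c = d - 2`. In characteristic 2
the pure second derivatives vanish and the partials have odd degree `d - 1`, so Euler's formula for
each partial says that the gradient of `B` is the cross product of `(x, y, z)` and `P`
(`gradient_eq_minors`). Thus Σ is determinantal: its equations are the maximal minors of a 3 × 2
matrix with columns of degrees 1 and `c`.

If Σ is finite, some line `l = z - α x - β y` misses it, and the Hilbert–Burch complex of the matrix
is exact. This is proved by hand: modulo `l` the two columns generate the syzygies of the minors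
(`syzygy_of_chartForm_dvd`); hence `l` is a nonzerodivisor modulo the ideal, and an induction on the
degree removes the words "modulo `l`". Counting dimensions in large degrees gives `(c + 1) * c + 1`
(`finrank_formsInChart`), which is therefore the dimension of the coordinate ring of Σ in the affine
chart `l = 1`, a chart containing all of Σ. That ring is Artinian, its localizations are the stalks
of Σ (`isLocalization_chartToStalk`), and over an algebraically closed field their lengths add up to
the dimension (`finsum_length_eq_finrank`). This is (2).

For (1), three conditions are imposed: `B` and its gradient have no common zero, `P` has no zero,
and Σ misses the line `z = 0`. Each is implied by the nonvanishing of a determinant in the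
coefficients of `B` (`exists_polynomial_of_no_zeros`), which is nonzero at `cyclicForm`. The first
condition makes every critical point strange, the third makes Σ finite. The second makes Σ reduced
(`isReduced_of_mixedPartials`): the Jacobian matrix of the equations is the Hessian, an alternating
matrix whose kernel at a point is spanned by `P`, and on Σ this is the radial direction, so there
are no tangent vectors. Then the number of points equals the dimension. -/

theorem homogeneousComponent_mul_of_le {f g : MvPolynomial σ R} {m n : ℕ}
    (hf : f.IsHomogeneous m) (h : m ≤ n) :
    homogeneousComponent n (f * g) = f * homogeneousComponent (n - m) g := by
  have := DirectSum.coe_decompose_mul_of_left_mem_of_le (homogeneousSubmodule σ R) (b := g)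
    ((mem_homogeneousSubmodule _ _).2 hf) h
  exact (decomposition.decompose'_apply _ _).symm.trans
    (this.trans (congrArg _ (decomposition.decompose'_apply _ _)))

theorem homogeneousComponent_mul_of_lt {f g : MvPolynomial σ R} {m n : ℕ}
    (hf : f.IsHomogeneous m) (h : n < m) : homogeneousComponent n (f * g) = 0 := by
  have := DirectSum.coe_decompose_mul_of_left_mem_of_not_le (homogeneousSubmodule σ R) (b := g)
    ((mem_homogeneousSubmodule _ _).2 hf) h.not_ge
  exact (decomposition.decompose'_apply _ _).symm.trans this

theorem homogeneousComponent_mul_add {f g : MvPolynomial σ R} {m n : ℕ}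
    (hf : f.IsHomogeneous m) :
    homogeneousComponent (m + n) (f * g) = f * homogeneousComponent n g := by
  rw [homogeneousComponent_mul_of_le hf (Nat.le_add_right _ _), Nat.add_sub_cancel_left]

end General

theorem exists_X_pow_mem_span {K : Type*} [Field K] [IsAlgClosed K] {σ : Type*} [Finite σ]
    {s : Set (MvPolynomial σ K)} (hs : ∀ v : σ → K, (∀ f ∈ s, eval v f = 0) → v = 0) (i : σ) :
    ∃ N, (X i : MvPolynomial σ K) ^ N ∈ Ideal.span s := by
  rw [← Ideal.mem_radical_iff, ← vanishingIdeal_zeroLocus_eq_radical (K := K)]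
  rw [mem_vanishingIdeal_iff]
  intro v hv
  have : v = 0 := hs v fun f hf => by
    have := hv f (Ideal.subset_span hf)
    rwa [aeval_eq_eval] at this
  simp [this]

theorem exists_forall_X_pow_mem_span {K : Type*} [Field K] [IsAlgClosed K] {σ : Type*} [Finite σ]
    {s : Set (MvPolynomial σ K)} (hs : ∀ v : σ → K, (∀ f ∈ s, eval v f = 0) → v = 0) :
    ∃ N, ∀ i, (X i : MvPolynomial σ K) ^ N ∈ Ideal.span s := by
  choose N hN using exists_X_pow_mem_span hs
  obtain ⟨M, hM⟩ := Set.finite_range N |>.bddAbove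
  exact ⟨M, fun i => Ideal.pow_mem_of_pow_mem _ (hN i) (hM ⟨i, rfl⟩)⟩

theorem not_X_dvd_X_pow {K : Type*} [Field K] {σ : Type*} {i j : σ} (h : i ≠ j) (n : ℕ) :
    ¬ (X i : MvPolynomial σ K) ∣ X j ^ n := fun hd => by
  exact h (X_dvd_X.mp ((X_prime (R := K) (i := i)).dvd_of_dvd_pow hd))

theorem X_pow_dvd_of_mul_eq {K : Type*} [Field K] {σ : Type*} {i j : σ} (h : i ≠ j) {m n : ℕ}
    {f g : MvPolynomial σ K} (hfg : X j ^ n * f = X i ^ m * g) : X i ^ m ∣ f :=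
  (X_prime (R := K) (i := i)).pow_dvd_of_dvd_mul_left m (not_X_dvd_X_pow h n) ⟨g, hfg⟩

/-! ### The maximal minors of a matrix with columns `(X 0, X 1, X 2)` and `P` -/

section Minors

variable {K : Type*} [Field K]

/-- In characteristic two, the entries of the cross product of `(X 0, X 1, X 2)` and `P`. -/
def minors (P : Fin 3 → MvPolynomial (Fin 3) K) : Fin 3 → MvPolynomial (Fin 3) K :=
  ![X 1 * P 2 + X 2 * P 1, X 0 * P 2 + X 2 * P 0, X 0 * P 1 + X 1 * P 0]

/-- The linear form `z - α x - β y`. -/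
def chartForm (α β : K) : MvPolynomial (Fin 3) K := X 2 - (C α * X 0 + C β * X 1)

/-- The restriction of polynomials to the plane `z = α x + β y`. -/
def restrict (α β : K) : MvPolynomial (Fin 3) K →ₐ[K] MvPolynomial (Fin 3) K :=
  aeval ![X 0, X 1, C α * X 0 + C β * X 1]

theorem minors_isHomogeneous {P : Fin 3 → MvPolynomial (Fin 3) K} {c : ℕ}
    (hP : ∀ i, (P i).IsHomogeneous c) (i : Fin 3) : (minors P i).IsHomogeneous (c + 1) := by
  have h : ∀ i j, (X i * P j).IsHomogeneous (c + 1) := fun i j =>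
    add_comm 1 c ▸ (isHomogeneous_X K i).mul (hP j)
  fin_cases i
  exacts [(h 1 2).add (h 2 1), (h 0 2).add (h 2 0), (h 0 1).add (h 1 0)]

theorem chartForm_isHomogeneous (α β : K) : (chartForm α β).IsHomogeneous 1 :=
  (isHomogeneous_X K _).sub ((isHomogeneous_C_mul_X _ _).add (isHomogeneous_C_mul_X _ _))

@[simp] theorem restrict_X_zero (α β : K) : restrict α β (X 0) = X 0 := by simp [restrict]

@[simp] theorem restrict_X_one (α β : K) : restrict α β (X 1) = X 1 := by simp [restrict]

@[simp] theorem restrict_X_two (α β : K) :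
    restrict α β (X 2) = C α * X 0 + C β * X 1 := by simp [restrict]

@[simp] theorem restrict_C (α β a : K) : restrict α β (C a) = C a := by
  simp [restrict]

@[simp] theorem restrict_chartForm (α β : K) : restrict α β (chartForm α β) = 0 := by
  simp [chartForm]

theorem chartForm_ne_zero (α β : K) : chartForm α β ≠ 0 := fun h => by
  have := congrArg (eval ![0, 0, 1]) h
  simp [chartForm] at this

theorem chartForm_dvd_sub_restrict (α β : K) (f : MvPolynomial (Fin 3) K) :
    chartForm α β ∣ f - restrict α β f := by
  induction f using MvPolynomial.induction_on with
  | C a => simp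
  | add f g hf hg =>
    rw [map_add, add_sub_add_comm]
    exact dvd_add hf hg
  | mul_X f i hf =>
    have hX : chartForm α β ∣ X i - restrict α β (X i) := by
      fin_cases i
      · simp
      · simp
      · simp [chartForm]
    have : f * X i - restrict α β (f * X i) =
        (f - restrict α β f) * X i + restrict α β f * (X i - restrict α β (X i)) := by
      rw [map_mul]; ring
    rw [this]
    exact dvd_add (hf.mul_right _) (hX.mul_left _)

theorem eval_restrict (α β : K) (f : MvPolynomial (Fin 3) K) {v : Fin 3 → K}
    (hv : eval v (chartForm α β) = 0) : eval v (restrict α β f) = eval v f := by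
  obtain ⟨g, hg⟩ := chartForm_dvd_sub_restrict α β f
  have := congrArg (eval v) hg
  rw [map_sub, map_mul, hv, zero_mul, sub_eq_zero] at this
  exact this.symm

variable [CharP K 2]

theorem two_eq_zero_mvPolynomial : (2 : MvPolynomial (Fin 3) K) = 0 := CharTwo.two_eq_zero

theorem sum_X_mul_minors (P : Fin 3 → MvPolynomial (Fin 3) K) :
    ∑ i, X i * minors P i = 0 := by
  simp only [Fin.sum_univ_three, minors, Matrix.cons_val]
  linear_combination (X 0 * X 1 * P 2 + X 0 * X 2 * P 1 + X 1 * X 2 * P 0) *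
    two_eq_zero_mvPolynomial (K := K)

theorem sum_mul_minors_self (P : Fin 3 → MvPolynomial (Fin 3) K) :
    ∑ i, P i * minors P i = 0 := by
  simp only [Fin.sum_univ_three, minors, Matrix.cons_val]
  linear_combination (X 0 * P 1 * P 2 + X 1 * P 0 * P 2 + X 2 * P 0 * P 1) *
    two_eq_zero_mvPolynomial (K := K)

variable [IsAlgClosed K] {P : Fin 3 → MvPolynomial (Fin 3) K} {c : ℕ} {α β : K}

/-- If the minors have no common zero on the line `z = α x + β y`, then modulo the equation
of that line their syzygies are generated by the two columns. -/
theorem syzygy_of_chartForm_dvd (hP : ∀ i, (P i).IsHomogeneous c)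
    (hV : ∀ v, (∀ i, eval v (minors P i) = 0) → eval v (chartForm α β) = 0 → v = 0)
    {u : Fin 3 → MvPolynomial (Fin 3) K} (hu : chartForm α β ∣ ∑ i, u i * minors P i) :
    ∃ t w, ∃ v : Fin 3 → MvPolynomial (Fin 3) K,
      ∀ i, u i = t * X i + w * P i + chartForm α β * v i := by
  have h2 := two_eq_zero_mvPolynomial (K := K)
  set ρ := restrict α β with hρ
  set p := fun i => ρ (P i) with hp
  -- On the plane, `c'` is the linear form `z - α x - β y` applied to `P`, up to signs. The other
  -- two minors restrict to combinations of `c'` and `D`, so `c'` and `D` have no common zero on the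
  -- line.
  set c' := p 2 + C α * p 0 + C β * p 1 with hc'
  set D := ρ (minors P 2) with hD
  have hD' : D = X 0 * p 1 + X 1 * p 0 := by simp [hD, minors, hp, hρ]
  have h0 : ρ (minors P 0) = X 1 * c' + C α * D := by
    simp only [minors, Matrix.cons_val, map_add, map_mul, hρ, restrict_X_one, restrict_X_two, hD',
      hc', hp]
    linear_combination (- X 1 * C α * restrict α β (P 0)) * h2
  have h1 : ρ (minors P 1) = X 0 * c' + C β * D := by
    simp only [minors, Matrix.cons_val, map_add, map_mul, hρ, restrict_X_zero, restrict_X_two, hD',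
      hc', hp]
    linear_combination (- X 0 * C β * restrict α β (P 1)) * h2
  have hDeg : D.IsHomogeneous (c + 1) := by
    have := (minors_isHomogeneous hP 2).aeval (τ := Fin 3) (S := K) (n := 1)
      ![X 0, X 1, C α * X 0 + C β * X 1] (fun i => by
        fin_cases i
        · exact isHomogeneous_X _ _
        · exact isHomogeneous_X _ _
        · exact (isHomogeneous_C_mul_X _ _).add (isHomogeneous_C_mul_X _ _))
    rwa [one_mul] at this
  obtain ⟨N, hN⟩ := exists_forall_X_pow_mem_span (σ := Fin 3)
    (s := {c', D, chartForm α β}) (fun v hv => by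
      have hl := hv _ (by simp : chartForm α β ∈ _)
      have hcv := hv _ (by simp : c' ∈ _)
      have hdv := hv _ (by simp : D ∈ _)
      refine hV v (fun i => ?_) hl
      rw [← eval_restrict α β _ hl]
      fin_cases i
      · exact (congrArg (eval v) h0).trans (by simp [hcv, hdv])
      · exact (congrArg (eval v) h1).trans (by simp [hcv, hdv])
      · exact hdv)
  have hρρ : ∀ f, ρ (ρ f) = ρ f := fun f => by
    have : (ρ.comp ρ) = ρ := by
      ext i : 1
      fin_cases i <;> simp [hρ]
    exact DFunLike.congr_fun this f
  have hρc : ρ c' = c' := by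
    simp only [hc', map_add, map_mul, hp, hρρ]
    simp [hρ]
  -- The restriction is a projection that fixes `c'` and `D` and kills `chartForm α β`.
  have hmem : ∀ f ∈ Ideal.span ({c', D, chartForm α β} : Set (MvPolynomial (Fin 3) K)),
      ∃ a b, ρ f = c' * a + D * b := fun f hf => by
    rw [Ideal.mem_span_insert] at hf
    obtain ⟨a, z, hz, rfl⟩ := hf
    rw [Ideal.mem_span_pair] at hz
    obtain ⟨b, e, rfl⟩ := hz
    refine ⟨ρ a, ρ b, ?_⟩
    rw [map_add, map_add, map_mul, map_mul, map_mul, hρc, hD, hρρ, hρ, restrict_chartForm]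
    ring
  obtain ⟨a, b, hab⟩ := hmem _ (hN 0)
  obtain ⟨a', b', hab'⟩ := hmem _ (hN 1)
  rw [map_pow] at hab hab'
  replace hab : X 0 ^ N = c' * a + D * b := by rw [← hab, hρ, restrict_X_zero]
  replace hab' : X 1 ^ N = c' * a' + D * b' := by rw [← hab', hρ, restrict_X_one]
  -- `c'` is nonzero and a factor of every `s` with `s * D` divisible by `c'`
  have hc0 : c' ≠ 0 := fun h => by
    -- If `c' = 0`, then `D` divides powers of both `X 0` and `X 1`, so it is a unit, although it is
    -- a form of degree `c + 1 > 0`.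
    rw [h, zero_mul, zero_add] at hab hab'
    have hb : X 1 ^ N * b = X 0 ^ N * b' := by rw [hab, hab']; ring
    obtain ⟨g, rfl⟩ := X_pow_dvd_of_mul_eq (by decide) hb
    have hX : (X 0 ^ N : MvPolynomial (Fin 3) K) ≠ 0 := pow_ne_zero _ (X_ne_zero _)
    have h1 : D * g = 1 := mul_left_cancel₀ hX (by linear_combination -hab)
    have h2 := congrArg (eval (0 : Fin 3 → K)) h1
    have h3 : eval (0 : Fin 3 → K) D = 0 := by
      rw [eval_zero, constantCoeff_eq]
      exact hDeg.coeff_eq_zero (by simp)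
    rw [map_mul, h3, zero_mul, map_one] at h2
    exact zero_ne_one h2
  have hdvd : ∀ s, c' ∣ s * D → c' ∣ s := fun s ⟨g, hg⟩ => by
    -- Since `X 0 ^ N` and `X 1 ^ N` lie in `(c', D)`, both send `s` into `(c')`; as they are
    -- coprime, comparing the two cofactors gives `s` itself.
    have e0 : X 0 ^ N * s = c' * (a * s + g * b) := by rw [hab]; linear_combination b * hg
    have e1 : X 1 ^ N * s = c' * (a' * s + g * b') := by rw [hab']; linear_combination b' * hg
    have e2 : X 1 ^ N * (a * s + g * b) = X 0 ^ N * (a' * s + g * b') :=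
      mul_left_cancel₀ hc0 (by linear_combination X 0 ^ N * e1 - X 1 ^ N * e0)
    obtain ⟨q, hq⟩ := X_pow_dvd_of_mul_eq (by decide) e2
    have hX : (X 0 ^ N : MvPolynomial (Fin 3) K) ≠ 0 := pow_ne_zero _ (X_ne_zero _)
    exact ⟨q, mul_left_cancel₀ hX (by rw [e0, hq]; ring)⟩
  -- The restricted syzygy is a relation between `c'` and `D`, which form a regular sequence; this
  -- yields `w`. Then `D = X 0 * p 1 + X 1 * p 0` and the coprimality of `X 0` and `X 1` yield `t`.
  have hsyz : (X 1 * ρ (u 0) + X 0 * ρ (u 1)) * c' +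
      (ρ (u 2) + C α * ρ (u 0) + C β * ρ (u 1)) * D = 0 := by
    obtain ⟨q, hq⟩ := hu
    have := congrArg ρ hq
    rw [map_mul, hρ, restrict_chartForm, zero_mul, ← hρ, Fin.sum_univ_three, map_add, map_add,
      map_mul, map_mul, map_mul, h0, h1, ← hD] at this
    linear_combination this
  obtain ⟨w, hw⟩ := hdvd (ρ (u 2) + C α * ρ (u 0) + C β * ρ (u 1))
    ⟨-(X 1 * ρ (u 0) + X 0 * ρ (u 1)), by linear_combination hsyz⟩
  have hsyz' : X 1 * ρ (u 0) + X 0 * ρ (u 1) + w * D = 0 :=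
    mul_left_cancel₀ hc0 (by rw [hw] at hsyz; linear_combination hsyz)
  rw [hD'] at hsyz'
  have hdv : (X 0 : MvPolynomial (Fin 3) K) ^ 1 ∣ ρ (u 0) + w * p 0 := by
    refine X_pow_dvd_of_mul_eq (j := 1) (n := 1) (by decide) (g := - (ρ (u 1) + w * p 1)) ?_
    linear_combination hsyz'
  obtain ⟨t, ht⟩ := hdv
  have ht1 : ρ (u 1) + w * p 1 = - X 1 * t :=
    mul_left_cancel₀ (X_ne_zero (R := K) (0 : Fin 3))
      (by linear_combination hsyz' - X 1 * ht)
  have key : ∀ i, ρ (u i) = t * ρ (X i) + w * p i := fun i => by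
    fin_cases i
    · simp only [hρ, Fin.zero_eta, restrict_X_zero]
      linear_combination ht - w * p 0 * h2
    · simp only [hρ, Fin.mk_one, restrict_X_one]
      linear_combination ht1 - (X 1 * t + w * p 1) * h2
    · simp only [hρ, Fin.reduceFinMk, restrict_X_two]
      rw [hc'] at hw
      linear_combination hw - C α * ht - C β * ht1 +
        (C α * w * p 0 + C β * w * p 1 + (- C α * X 0) * t) * h2
  have hv : ∀ i, ∃ v, u i = t * X i + w * P i + chartForm α β * v := fun i => by
    obtain ⟨a, ha⟩ := chartForm_dvd_sub_restrict α β (u i)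
    obtain ⟨b, hb⟩ := chartForm_dvd_sub_restrict α β (X i)
    obtain ⟨e, he⟩ := chartForm_dvd_sub_restrict α β (P i)
    refine ⟨a - t * b - w * e, ?_⟩
    have := key i
    simp only [hp, hρ] at this
    linear_combination ha + this - t * hb - w * he
  choose v hv using hv
  exact ⟨t, w, v, hv⟩

end Minors

/-! ### Spaces of forms -/

section Forms

variable {K : Type*} [Field K]

theorem mem_finsuppAntidiag_univ_iff {n : ℕ} {m : Fin 3 →₀ ℕ} :
    m ∈ (Finset.univ : Finset (Fin 3)).finsuppAntidiag n ↔ m.degree = n := by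
  rw [Finset.mem_finsuppAntidiag, Finsupp.degree_eq_sum]
  simp

theorem finrank_homogeneousSubmodule (n : ℕ) :
    Module.finrank K (homogeneousSubmodule (Fin 3) K n) = (n + 2).choose 2 := by
  rw [homogeneousSubmodule_eq_finsupp_supported]
  change Module.finrank K (restrictSupport K {d : Fin 3 →₀ ℕ | d.degree = n}) = _
  rw [Module.finrank_eq_nat_card_basis (basisRestrictSupport K {d : Fin 3 →₀ ℕ | d.degree = n})]
  have : {d : Fin 3 →₀ ℕ | d.degree = n} =
      ((Finset.univ : Finset (Fin 3)).finsuppAntidiag n : Set (Fin 3 →₀ ℕ)) := by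
    ext m
    rw [Finset.mem_coe, mem_finsuppAntidiag_univ_iff, Set.mem_ofPred_eq]
  rw [this, Nat.card_coe_set_eq, Set.ncard_coe_finset, Finset.card_finsuppAntidiag_nat_eq_choose]
  simp only [Finset.card_univ, Fintype.card_fin]
  rw [Nat.add_comm n 2, Nat.choose_symm_add, show 3 + n - 1 = 2 + n by omega]

instance homogeneousSubmodule_finite (n : ℕ) :
    Module.Finite K (homogeneousSubmodule (Fin 3) K n) :=
  Module.Finite.iff_fg.2 (homogeneousSubmodule_fg _ _ n)

/-- Multiplication by a form, as a linear map between spaces of forms. -/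
def mulForm {f : MvPolynomial (Fin 3) K} {m n N : ℕ} (hf : f.IsHomogeneous m) (h : m + n = N) :
    homogeneousSubmodule (Fin 3) K n →ₗ[K] homogeneousSubmodule (Fin 3) K N :=
  (LinearMap.mulLeft K f).restrict fun _ hg => h ▸ hf.mul hg

@[simp] theorem coe_mulForm {f : MvPolynomial (Fin 3) K} {m n N : ℕ} (hf : f.IsHomogeneous m)
    (h : m + n = N) (g : homogeneousSubmodule (Fin 3) K n) :
    (mulForm hf h g : MvPolynomial (Fin 3) K) = f * g := rfl

end Forms

/-! ### Dehomogenization with respect to a linear form -/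

section Chart

variable {K : Type*} [Field K]

/-- The ideal of the affine chart `z - α x - β y = 1` of the scheme defined by `J`. -/
def chartIdeal (J : Ideal (MvPolynomial (Fin 3) K)) (α β : K) :
    Ideal (MvPolynomial (Fin 3) K) :=
  J ⊔ Ideal.span {chartForm α β - 1}

theorem le_chartIdeal (J : Ideal (MvPolynomial (Fin 3) K)) (α β : K) : J ≤ chartIdeal J α β :=
  le_sup_left

theorem chartForm_sub_one_mem (J : Ideal (MvPolynomial (Fin 3) K)) (α β : K) :
    chartForm α β - 1 ∈ chartIdeal J α β :=
  le_sup_right (a := J) (Ideal.subset_span rfl)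

theorem chartForm_pow_sub_one_dvd (α β : K) (k : ℕ) :
    chartForm α β - 1 ∣ chartForm α β ^ k - 1 := by
  simpa using sub_dvd_pow_sub_pow (chartForm α β) 1 k

theorem exists_form_sub_dvd (α β : K) (f : MvPolynomial (Fin 3) K) {n : ℕ}
    (hn : f.totalDegree ≤ n) :
    ∃ F : MvPolynomial (Fin 3) K, F.IsHomogeneous n ∧ chartForm α β - 1 ∣ F - f := by
  refine ⟨∑ i ∈ Finset.range (n + 1), chartForm α β ^ (n - i) * homogeneousComponent i f,
    IsHomogeneous.sum _ _ _ fun i hi => ?_, ?_⟩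
  · have h := ((chartForm_isHomogeneous α β).pow (n - i)).mul
      (homogeneousComponent_isHomogeneous i f)
    rwa [one_mul, Nat.sub_add_cancel (Nat.lt_succ_iff.1 (Finset.mem_range.1 hi))] at h
  · have hf : f = ∑ i ∈ Finset.range (n + 1), homogeneousComponent i f := by
      conv_lhs => rw [← sum_homogeneousComponent f]
      refine Finset.sum_subset (Finset.range_mono (by omega)) fun i _ hi => ?_
      exact homogeneousComponent_eq_zero _ _ (by simpa using hi)
    refine (congrArg (chartForm α β - 1 ∣ _ - ·) hf).mpr ?_
    rw [← Finset.sum_sub_distrib]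
    refine Finset.dvd_sum fun i _ => ?_
    rw [← sub_one_mul]
    exact (chartForm_pow_sub_one_dvd α β _).mul_right _

/-- With `F = j + g * (l - 1)` and `j ∈ J`, compare homogeneous components modulo `J`: those of `g`
vanish below degree `n`, and the one of degree `n + k` is `-l ^ k * F`. It is zero once `n + k`
exceeds the degree of `g`. -/
theorem exists_chartForm_pow_mul_mem {J : Ideal (MvPolynomial (Fin 3) K)}
    (hJ : J.IsHomogeneous (homogeneousSubmodule (Fin 3) K)) {α β : K} {n : ℕ}
    {F : MvPolynomial (Fin 3) K} (hF : F.IsHomogeneous n) (h : F ∈ chartIdeal J α β) :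
    ∃ k, chartForm α β ^ k * F ∈ J := by
  obtain ⟨j, hj, r, hr, hjr⟩ := Submodule.mem_sup.1 h
  obtain ⟨g, rfl⟩ := Ideal.mem_span_singleton'.1 hr
  set l := chartForm α β with hl
  have hl1 : l.IsHomogeneous 1 := chartForm_isHomogeneous α β
  have hjF : j = F + g - l * g := by rw [← hjr]; ring
  have h0 : homogeneousComponent 0 F + homogeneousComponent 0 g ∈ J := by
    have := homogeneousComponent_mem_of_mem hJ hj 0
    rwa [hjF, map_sub, homogeneousComponent_mul_of_lt hl1 one_pos, sub_zero, map_add] at this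
  have hs : ∀ i, homogeneousComponent (i + 1) F + homogeneousComponent (i + 1) g -
      l * homogeneousComponent i g ∈ J := fun i => by
    have := homogeneousComponent_mem_of_mem hJ hj (i + 1)
    rwa [hjF, map_sub, homogeneousComponent_mul_of_le hl1 (by omega), map_add,
      Nat.add_sub_cancel] at this
  have hF0 : ∀ i, i ≠ n → homogeneousComponent i F = 0 := fun i hi => by
    rw [homogeneousComponent_of_mem hF, if_neg hi]
  have hFn : homogeneousComponent n F = F := homogeneousComponent_eq_self hF
  have hlow : ∀ i, i < n → homogeneousComponent i g ∈ J := fun i => by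
    induction i with
    | zero =>
      intro hi
      rwa [hF0 0 hi.ne, zero_add] at h0
    | succ i ih =>
      intro hi
      have := J.add_mem (hs i) (J.mul_mem_left l (ih (by omega)))
      rwa [hF0 _ hi.ne, zero_add, sub_add_cancel] at this
  have hmid : F + homogeneousComponent n g ∈ J := by
    rcases n with _ | n
    · rwa [hFn] at h0
    · have := J.add_mem (hs n) (J.mul_mem_left l (hlow n (by omega)))
      rwa [hFn, sub_add_cancel] at this
  have hhigh : ∀ k, l ^ k * F + homogeneousComponent (n + k) g ∈ J := fun k => by
    induction k with
    | zero => simpa using hmid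
    | succ k ih =>
      have := J.add_mem (J.mul_mem_left l ih) (hs (n + k))
      rw [hF0 _ (by omega), zero_add] at this
      convert this using 1
      rw [add_assoc n k 1]
      ring
  refine ⟨g.totalDegree + 1, ?_⟩
  have := hhigh (g.totalDegree + 1)
  rwa [homogeneousComponent_eq_zero _ _ (by omega), add_zero] at this

/-- The image in the coordinate ring of the affine chart of the forms of degree `n`. -/
def formsInChart (J : Ideal (MvPolynomial (Fin 3) K)) (α β : K) (n : ℕ) :
    Submodule K (MvPolynomial (Fin 3) K ⧸ chartIdeal J α β) :=
  (homogeneousSubmodule (Fin 3) K n).map (Ideal.Quotient.mkₐ K (chartIdeal J α β)).toLinearMap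

theorem mk_chartForm (J : Ideal (MvPolynomial (Fin 3) K)) (α β : K) :
    Ideal.Quotient.mk (chartIdeal J α β) (chartForm α β) = 1 := by
  rw [← map_one (Ideal.Quotient.mk (chartIdeal J α β)), Ideal.Quotient.eq]
  exact chartForm_sub_one_mem J α β

theorem formsInChart_mono (J : Ideal (MvPolynomial (Fin 3) K)) (α β : K) :
    Monotone (formsInChart J α β) := by
  refine monotone_nat_of_le_succ fun n => ?_
  rintro _ ⟨F, hF, rfl⟩
  refine ⟨F * chartForm α β, IsHomogeneous.mul hF (chartForm_isHomogeneous α β), ?_⟩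
  simp [mk_chartForm]

theorem exists_mem_formsInChart (J : Ideal (MvPolynomial (Fin 3) K)) (α β : K)
    (a : MvPolynomial (Fin 3) K ⧸ chartIdeal J α β) : ∃ n, a ∈ formsInChart J α β n := by
  obtain ⟨f, rfl⟩ := Ideal.Quotient.mk_surjective a
  obtain ⟨F, hF, hd⟩ := exists_form_sub_dvd α β f le_rfl
  refine ⟨_, F, hF, ?_⟩
  refine (Ideal.Quotient.eq).2 ?_
  exact (chartIdeal J α β).mem_of_dvd hd (chartForm_sub_one_mem J α β)

/-- The images of the spaces of forms increase with the degree, as `l` maps to 1, and exhaust the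
ring; constant dimension makes them stationary. -/
theorem finite_and_finrank_of_formsInChart {J : Ideal (MvPolynomial (Fin 3) K)} {α β : K}
    {n₀ N : ℕ} (h : ∀ n, n₀ ≤ n → Module.finrank K (formsInChart J α β n) = N) :
    Module.Finite K (MvPolynomial (Fin 3) K ⧸ chartIdeal J α β) ∧
      Module.finrank K (MvPolynomial (Fin 3) K ⧸ chartIdeal J α β) = N := by
  have hfin : ∀ n, Module.Finite K (formsInChart J α β n) := fun n => by
    unfold formsInChart
    infer_instance
  have heq : ∀ n, n₀ ≤ n → formsInChart J α β n₀ = formsInChart J α β n := fun n hn =>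
    Submodule.eq_of_le_of_finrank_eq (formsInChart_mono J α β hn) (by rw [h _ le_rfl, h n hn])
  have htop : formsInChart J α β n₀ = ⊤ := by
    refine eq_top_iff.2 fun a _ => ?_
    obtain ⟨n, hn⟩ := exists_mem_formsInChart J α β a
    rw [heq (max n n₀) (le_max_right _ _)]
    exact formsInChart_mono J α β (le_max_left _ _) hn
  have hf := hfin n₀
  have hr := h n₀ le_rfl
  rw [htop] at hf hr
  rw [finrank_top] at hr
  exact ⟨Module.Finite.equiv Submodule.topEquiv, hr⟩

end Chart

/-! ### The Hilbert function of the ideal of minors -/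

section Hilbert

variable {K : Type*} [Field K]

/-- The ideal generated by the minors. -/
def minorsIdeal (P : Fin 3 → MvPolynomial (Fin 3) K) : Ideal (MvPolynomial (Fin 3) K) :=
  Ideal.span (Set.range (minors P))

theorem mem_minorsIdeal {P : Fin 3 → MvPolynomial (Fin 3) K} {f : MvPolynomial (Fin 3) K} :
    f ∈ minorsIdeal P ↔ ∃ u : Fin 3 → MvPolynomial (Fin 3) K, ∑ i, u i * minors P i = f :=
  Ideal.mem_span_range_iff_exists_fun

theorem minorsIdeal_isHomogeneous {P : Fin 3 → MvPolynomial (Fin 3) K} {c : ℕ}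
    (hP : ∀ i, (P i).IsHomogeneous c) :
    (minorsIdeal P).IsHomogeneous (homogeneousSubmodule (Fin 3) K) := by
  refine Ideal.homogeneous_span _ _ ?_
  rintro _ ⟨i, rfl⟩
  exact ⟨c + 1, minors_isHomogeneous hP i⟩

theorem exists_minors_ne_zero {P : Fin 3 → MvPolynomial (Fin 3) K} {α β : K}
    (hV : ∀ v, (∀ i, eval v (minors P i) = 0) → eval v (chartForm α β) = 0 → v = 0) :
    ∃ i, minors P i ≠ 0 := by
  by_contra! h
  have := congrFun (hV ![1, 0, α] (fun i => by rw [h, map_zero]) (by simp [chartForm])) 0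
  simp at this

variable [CharP K 2]

theorem sum_columns_mul_minors (P : Fin 3 → MvPolynomial (Fin 3) K)
    (t w l : MvPolynomial (Fin 3) K) (v : Fin 3 → MvPolynomial (Fin 3) K) :
    ∑ i, (t * X i + w * P i + l * v i) * minors P i = l * ∑ i, v i * minors P i := by
  have h1 := sum_X_mul_minors P
  have h2 := sum_mul_minors_self P
  simp only [Fin.sum_univ_three] at *
  linear_combination t * h1 + w * h2

/-- Eliminating `t` from two of the equations leaves `w` times a minor. -/
theorem eq_zero_of_columns {P : Fin 3 → MvPolynomial (Fin 3) K} (h0 : ∃ i, minors P i ≠ 0)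
    {t w : MvPolynomial (Fin 3) K}
    (h : ∀ i, t * X i + w * P i = 0) : t = 0 ∧ w = 0 := by
  have hw : w = 0 := by
    obtain ⟨i, hi⟩ := h0
    refine (mul_eq_zero.1 ?_).resolve_right hi
    have e0 := h 0
    have e1 := h 1
    have e2 := h 2
    have h2 := two_eq_zero_mvPolynomial (K := K)
    fin_cases i
    · simp only [minors, Fin.zero_eta, Matrix.cons_val]
      linear_combination X 1 * e2 + X 2 * e1 - t * X 1 * X 2 * h2
    · simp only [minors, Fin.mk_one, Matrix.cons_val]
      linear_combination X 0 * e2 + X 2 * e0 - t * X 0 * X 2 * h2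
    · simp only [minors, Fin.reduceFinMk, Matrix.cons_val]
      linear_combination X 0 * e1 + X 1 * e0 - t * X 0 * X 1 * h2
  refine ⟨?_, hw⟩
  have := h 0
  rw [hw, zero_mul, add_zero] at this
  exact (mul_eq_zero.1 this).resolve_right (X_ne_zero _)

variable [IsAlgClosed K] {P : Fin 3 → MvPolynomial (Fin 3) K} {c : ℕ} {α β : K}

/-- The coefficients of `l * f` form a syzygy modulo `l`, hence equal a combination of the columns
plus `l * v`. The columns contribute nothing, and cancelling `l` shows that `v` expresses `f`. -/
theorem mem_minorsIdeal_of_chartForm_mul_mem (hP : ∀ i, (P i).IsHomogeneous c)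
    (hV : ∀ v, (∀ i, eval v (minors P i) = 0) → eval v (chartForm α β) = 0 → v = 0)
    {f : MvPolynomial (Fin 3) K} (h : chartForm α β * f ∈ minorsIdeal P) :
    f ∈ minorsIdeal P := by
  obtain ⟨u, hu⟩ := mem_minorsIdeal.1 h
  obtain ⟨t, w, v, hv⟩ := syzygy_of_chartForm_dvd hP hV (u := u) ⟨f, hu⟩
  refine mem_minorsIdeal.2 ⟨v, mul_left_cancel₀ (chartForm_ne_zero α β) ?_⟩
  rw [← hu, ← sum_columns_mul_minors P t w]
  simp only [hv]

theorem mem_minorsIdeal_of_mem_chartIdeal (hP : ∀ i, (P i).IsHomogeneous c)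
    (hV : ∀ v, (∀ i, eval v (minors P i) = 0) → eval v (chartForm α β) = 0 → v = 0)
    {n : ℕ} {F : MvPolynomial (Fin 3) K} (hF : F.IsHomogeneous n)
    (h : F ∈ chartIdeal (minorsIdeal P) α β) : F ∈ minorsIdeal P := by
  obtain ⟨k, hk⟩ := exists_chartForm_pow_mul_mem (minorsIdeal_isHomogeneous hP) hF h
  induction k with
  | zero => simpa using hk
  | succ k ih =>
    refine ih (mem_minorsIdeal_of_chartForm_mul_mem hP hV ?_)
    rwa [← mul_assoc, ← pow_succ']

/-- Subtracting the combination of columns found modulo `l` leaves `l` times a syzygy of degree one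
less, to which the induction applies. -/
theorem syzygy_of_isHomogeneous (hP : ∀ i, (P i).IsHomogeneous c)
    (hV : ∀ v, (∀ i, eval v (minors P i) = 0) → eval v (chartForm α β) = 0 → v = 0)
    (n : ℕ) {u : Fin 3 → MvPolynomial (Fin 3) K} (hn : ∀ i, (u i).IsHomogeneous n)
    (hu : ∑ i, u i * minors P i = 0) : ∃ t w, ∀ i, u i = t * X i + w * P i := by
  induction n generalizing u with
  | zero =>
    obtain ⟨t, w, v, hv⟩ := syzygy_of_chartForm_dvd hP hV (u := u) (hu ▸ dvd_zero _)
    have hX : ∀ i, homogeneousComponent 0 (t * X i) = 0 := fun i => by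
      rw [mul_comm, homogeneousComponent_mul_of_lt (isHomogeneous_X K i) one_pos]
    obtain ⟨w', hw'⟩ : ∃ w', ∀ i, homogeneousComponent 0 (w * P i) = w' * P i := by
      rcases Nat.eq_zero_or_pos c with rfl | hc
      · refine ⟨homogeneousComponent 0 w, fun i => ?_⟩
        rw [mul_comm, homogeneousComponent_mul_of_le (hP i) le_rfl, mul_comm]
      · refine ⟨0, fun i => ?_⟩
        rw [mul_comm, homogeneousComponent_mul_of_lt (hP i) hc, zero_mul]
    refine ⟨0, w', fun i => ?_⟩
    rw [← homogeneousComponent_eq_self (hn i), hv i, map_add, map_add, hX, hw',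
      homogeneousComponent_mul_of_lt (chartForm_isHomogeneous α β) one_pos]
    ring
  | succ n ih =>
    obtain ⟨t, w, v, hv⟩ := syzygy_of_chartForm_dvd hP hV (u := u) (hu ▸ dvd_zero _)
    have hX : ∀ i, homogeneousComponent (n + 1) (t * X i) = homogeneousComponent n t * X i :=
      fun i => by
        rw [mul_comm, homogeneousComponent_mul_of_le (isHomogeneous_X K i) (by omega), mul_comm,
          Nat.add_sub_cancel]
    -- When `c > n + 1` the column `P` cannot occur in this degree, so its coefficient is 0.
    obtain ⟨w', hw'⟩ : ∃ w', ∀ i, homogeneousComponent (n + 1) (w * P i) = w' * P i := by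
      rcases le_or_gt c (n + 1) with hc | hc
      · refine ⟨homogeneousComponent (n + 1 - c) w, fun i => ?_⟩
        rw [mul_comm, homogeneousComponent_mul_of_le (hP i) hc, mul_comm]
      · refine ⟨0, fun i => ?_⟩
        rw [mul_comm, homogeneousComponent_mul_of_lt (hP i) hc, zero_mul]
    have hu' : ∀ i, u i = homogeneousComponent n t * X i + w' * P i +
        chartForm α β * homogeneousComponent n (v i) := fun i => by
      rw [← homogeneousComponent_eq_self (hn i), hv i, map_add, map_add, hX, hw',
        homogeneousComponent_mul_of_le (chartForm_isHomogeneous α β) (by omega),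
        Nat.add_sub_cancel]
    obtain ⟨t', w'', h⟩ := ih (u := fun i => homogeneousComponent n (v i))
      (fun i => homogeneousComponent_isHomogeneous _ _) (by
        refine mul_left_cancel₀ (chartForm_ne_zero α β) ?_
        rw [← sum_columns_mul_minors P (homogeneousComponent n t) w', mul_zero, ← hu]
        simp only [hu'])
    refine ⟨homogeneousComponent n t + chartForm α β * t', w' + chartForm α β * w'', fun i => ?_⟩
    rw [hu', h]
    ring

/-- In degree `2 * c + 2 + k` the Hilbert–Burch complex consists of `ψ`, `φ` and `π`; its exactness
gives the dimension as an alternating sum of binomial coefficients. -/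
theorem finrank_formsInChart (hP : ∀ i, (P i).IsHomogeneous c)
    (hV : ∀ v, (∀ i, eval v (minors P i) = 0) → eval v (chartForm α β) = 0 → v = 0) (k : ℕ) :
    Module.finrank K (formsInChart (minorsIdeal P) α β (2 * c + 2 + k)) = (c + 1) * c + 1 := by
  let φ : (Fin 3 → homogeneousSubmodule (Fin 3) K (k + c + 1)) →ₗ[K]
      homogeneousSubmodule (Fin 3) K (2 * c + 2 + k) :=
    ∑ i, (mulForm (minors_isHomogeneous hP i) (by omega)).comp (LinearMap.proj i)
  let ψ : (homogeneousSubmodule (Fin 3) K (k + c) × homogeneousSubmodule (Fin 3) K (k + 1)) →ₗ[K]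
      (Fin 3 → homogeneousSubmodule (Fin 3) K (k + c + 1)) :=
    LinearMap.pi fun i =>
      (mulForm (isHomogeneous_X K i) (by omega)).comp (LinearMap.fst _ _ _) +
      (mulForm (hP i) (by omega)).comp (LinearMap.snd _ _ _)
  let π : homogeneousSubmodule (Fin 3) K (2 * c + 2 + k) →ₗ[K]
      (MvPolynomial (Fin 3) K ⧸ chartIdeal (minorsIdeal P) α β) :=
    (Ideal.Quotient.mkₐ K (chartIdeal (minorsIdeal P) α β)).toLinearMap.domRestrict _
  have hφ : ∀ u, (φ u : MvPolynomial (Fin 3) K) = ∑ i, (u i : MvPolynomial (Fin 3) K) * minors P i :=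
    fun u => by simp [φ, Fin.sum_univ_three, mul_comm]
  have hψ : ∀ a i, (ψ a i : MvPolynomial (Fin 3) K) =
      (a.1 : MvPolynomial (Fin 3) K) * X i + (a.2 : MvPolynomial (Fin 3) K) * P i :=
    fun a i => by simp [ψ, mul_comm]
  have hψinj : LinearMap.ker ψ = ⊥ := by
    refine LinearMap.ker_eq_bot'.2 fun a ha => ?_
    have := eq_zero_of_columns (t := a.1) (w := a.2) (exists_minors_ne_zero hV) fun i => by
      rw [← hψ, ha]; rfl
    exact Prod.ext (Subtype.ext this.1) (Subtype.ext this.2)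
  have hker : LinearMap.ker φ = LinearMap.range ψ := by
    ext u
    rw [LinearMap.mem_ker, LinearMap.mem_range]
    constructor
    · intro hu
      obtain ⟨t, w, h⟩ := syzygy_of_isHomogeneous hP hV _ (u := fun i => u i) (fun i => (u i).2)
        (by rw [← hφ, hu]; rfl)
      refine ⟨(⟨homogeneousComponent (k + c) t, homogeneousComponent_isHomogeneous _ _⟩,
        ⟨homogeneousComponent (k + 1) w, homogeneousComponent_isHomogeneous _ _⟩), ?_⟩
      ext i : 2
      rw [hψ, ← homogeneousComponent_eq_self (u i).2, h, map_add]
      congr 1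
      · rw [mul_comm t, homogeneousComponent_mul_of_le (isHomogeneous_X K i) (by omega), mul_comm,
          Nat.add_sub_cancel]
      · rw [mul_comm w, homogeneousComponent_mul_of_le (hP i) (by omega), mul_comm,
          show k + c + 1 - c = k + 1 by omega]
    · rintro ⟨a, rfl⟩
      refine Subtype.ext ?_
      rw [hφ, ZeroMemClass.coe_zero]
      have := sum_columns_mul_minors P a.1 a.2 0 0
      simp only [zero_mul, add_zero] at this
      simpa only [hψ] using this
  have hπ : LinearMap.ker π = LinearMap.range φ := by
    ext F
    rw [LinearMap.mem_ker, LinearMap.mem_range]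
    constructor
    · intro hF
      obtain ⟨u, hu⟩ := mem_minorsIdeal.1
        (mem_minorsIdeal_of_mem_chartIdeal hP hV F.2 (Ideal.Quotient.eq_zero_iff_mem.1 hF))
      refine ⟨fun i => ⟨homogeneousComponent (k + c + 1) (u i),
        homogeneousComponent_isHomogeneous _ _⟩, Subtype.ext ?_⟩
      rw [hφ, ← homogeneousComponent_eq_self F.2, ← hu, map_sum]
      refine Finset.sum_congr rfl fun i _ => ?_
      rw [mul_comm (u i), homogeneousComponent_mul_of_le (minors_isHomogeneous hP i) (by omega),
        mul_comm, show 2 * c + 2 + k - (c + 1) = k + c + 1 by omega]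
    · rintro ⟨u, rfl⟩
      refine Ideal.Quotient.eq_zero_iff_mem.2 (le_chartIdeal _ _ _ ?_)
      exact mem_minorsIdeal.2 ⟨fun i => u i, (hφ u).symm⟩
  have hrange : LinearMap.range π = formsInChart (minorsIdeal P) α β (2 * c + 2 + k) :=
    LinearMap.range_domRestrict _ _
  have e1 := LinearMap.finrank_range_add_finrank_ker π
  have e2 := LinearMap.finrank_range_add_finrank_ker φ
  have e3 := LinearMap.finrank_range_of_inj (LinearMap.ker_eq_bot.1 hψinj)
  rw [hrange, hπ, finrank_homogeneousSubmodule] at e1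
  rw [hker, e3, Module.finrank_prod, Module.finrank_pi_fintype] at e2
  simp only [finrank_homogeneousSubmodule, Finset.sum_const, Finset.card_univ, Fintype.card_fin,
    smul_eq_mul] at e2
  -- Over `ℚ` the binomial coefficients are polynomials and the subtraction is not truncated.
  have hc : ∀ n : ℕ, ((n + 2).choose 2 : ℚ) = (n + 2) * (n + 1) / 2 := fun n => by
    rw [Nat.cast_choose_two]; push_cast; ring
  have q1 : (_ : ℚ) = _ := congrArg Nat.cast e1
  have q2 : (_ : ℚ) = _ := congrArg Nat.cast e2
  push_cast [hc] at q1 q2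
  have : (Module.finrank K (formsInChart (minorsIdeal P) α β (2 * c + 2 + k)) : ℚ) =
      (c + 1) * c + 1 := by linear_combination q1 - q2
  exact_mod_cast this

theorem finite_and_finrank_chart (hP : ∀ i, (P i).IsHomogeneous c)
    (hV : ∀ v, (∀ i, eval v (minors P i) = 0) → eval v (chartForm α β) = 0 → v = 0) :
    Module.Finite K (MvPolynomial (Fin 3) K ⧸ chartIdeal (minorsIdeal P) α β) ∧
      Module.finrank K (MvPolynomial (Fin 3) K ⧸ chartIdeal (minorsIdeal P) α β) =
        (c + 1) * c + 1 :=
  finite_and_finrank_of_formsInChart (n₀ := 2 * c + 2) fun n hn => by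
    obtain ⟨k, rfl⟩ := Nat.exists_eq_add_of_le hn
    exact finrank_formsInChart hP hV k

end Hilbert

/-! ### Lengths of Artinian algebras over an algebraically closed field -/

section Length

variable {K : Type*} [Field K] [IsAlgClosed K]

/-- The residue field is `K`, so each simple factor has dimension 1 over `K`. -/
theorem length_self_eq_finrank_of_isLocalRing {A : Type*} [CommRing A] [IsLocalRing A] [Algebra K A]
    [Module.Finite K A] : Module.length A A = Module.finrank K A := by
  have hsurj : Function.Surjective (algebraMap K (IsLocalRing.ResidueField A)) := by
    have : Algebra.IsIntegral K (IsLocalRing.ResidueField A) :=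
      ⟨fun x => by
        obtain ⟨a, rfl⟩ := IsLocalRing.residue_surjective x
        exact (Algebra.IsIntegral.isIntegral (R := K) a).map
          (IsScalarTower.toAlgHom K A (IsLocalRing.ResidueField A))⟩
    exact IsAlgClosed.algebraMap_bijective_of_isIntegral.2
  have hloc : IsLocalHom (algebraMap K A) := inferInstance
  have h := IsLocalRing.length_restrictScalars K A A
  have h1 : Module.length (IsLocalRing.ResidueField K) (IsLocalRing.ResidueField A) = 1 := by
    rw [Module.length_eq_of_surjective (R := IsLocalRing.ResidueField A), Module.length_eq_one]
    intro x
    obtain ⟨a, ha⟩ := hsurj x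
    exact ⟨IsLocalRing.residue K a, ha⟩
  rw [h1, mul_one, Module.length_eq_finrank] at h
  exact h.symm

theorem sum_length_localization (R : Type*) [CommRing R] [Algebra K R] [Module.Finite K R]
    [IsArtinianRing R] [Fintype (MaximalSpectrum R)] :
    ∑ m : MaximalSpectrum R,
      Module.length (Localization.AtPrime m.asIdeal) (Localization.AtPrime m.asIdeal) =
        Module.finrank K R := by
  have hfin (m : MaximalSpectrum R) : Module.Finite K (Localization.AtPrime m.asIdeal) :=
    Module.Finite.of_surjective
      (Algebra.algHom K R (Localization.AtPrime m.asIdeal)).toLinearMap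
      (IsArtinianRing.localization_surjective m.asIdeal.primeCompl _)
  rw [((MaximalSpectrum.toPiLocalizationEquiv R).restrictScalars K).toLinearEquiv.finrank_eq,
    Module.finrank_pi_fintype]
  push_cast
  exact Finset.sum_congr rfl fun m _ => length_self_eq_finrank_of_isLocalRing

/-- Length does not change along a surjection of scalars, and localizing an Artinian ring is
surjective; so all lengths may be taken over `R`. -/
theorem length_eq_length_localization {R O Q : Type*} [CommRing R] [IsArtinianRing R] [CommRing O]
    [CommRing Q] [Algebra R Q] [Algebra O Q] (hO : Function.Surjective (algebraMap O Q))
    (m : Ideal R) [m.IsPrime] [IsLocalization.AtPrime Q m] :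
    Module.length O Q =
      Module.length (Localization.AtPrime m) (Localization.AtPrime m) := by
  rw [Module.length_eq_of_surjective (R := Q) hO,
    ← Module.length_eq_of_surjective (S := R) (R := Q)
      (IsArtinianRing.localization_surjective m.primeCompl Q),
    ← Module.length_eq_of_surjective (S := R) (R := Localization.AtPrime m)
      (IsArtinianRing.localization_surjective m.primeCompl _)]
  exact (IsLocalization.algEquiv m.primeCompl Q (Localization.AtPrime m)).toLinearEquiv.length_eq

end Length

/-! ### Points of the projective plane and of the affine chart -/

section Points

variable {K : Type*} [Field K] {α β : K}

theorem eval_smul_of_isHomogeneous {F : MvPolynomial (Fin 3) K} {n : ℕ} (hF : F.IsHomogeneous n)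
    (a : K) (v : Fin 3 → K) : eval (a • v) F = a ^ n * eval v F := by
  rw [eval_eq, eval_eq, Finset.mul_sum]
  refine Finset.sum_congr rfl fun m hm => ?_
  have hd : ∑ i ∈ m.support, m i = n := (hF.degree_eq_sum_deg_support hm).symm
  simp only [Pi.smul_apply, smul_eq_mul, mul_pow, Finset.prod_mul_distrib]
  rw [Finset.prod_pow_eq_pow_sum, hd]
  ring

/-- Used with `φ` the dehomogenization and `a` the localization map, which differ on each variable
by the factor `l`. -/
theorem map_mul_pow_eq_of_isHomogeneous {L : Type*} [CommRing L]
    (φ a : MvPolynomial (Fin 3) K →+* L) (l : L) (hC : ∀ r, φ (C r) = a (C r))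
    (hX : ∀ i, φ (X i) * l = a (X i)) {F : MvPolynomial (Fin 3) K} {n : ℕ}
    (hF : F.IsHomogeneous n) : φ F * l ^ n = a F := by
  rw [F.as_sum, map_sum, map_sum, Finset.sum_mul]
  refine Finset.sum_congr rfl fun m hm => ?_
  have hd : ∑ i ∈ m.support, m i = n := (hF.degree_eq_sum_deg_support hm).symm
  rw [monomial_eq, map_mul, map_mul, hC, mul_assoc, Finsupp.prod, map_prod, map_prod, ← hd,
    ← Finset.prod_pow_eq_pow_sum, ← Finset.prod_mul_distrib]
  congr 1
  refine Finset.prod_congr rfl fun i _ => ?_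
  rw [map_pow, map_pow, ← mul_pow, hX]

/-- The representative of a point on the plane `z - α x - β y = 1`. -/
def chartPoint (α β : K) (p : ℙ K (Fin 3 → K)) : Fin 3 → K :=
  (eval p.rep (chartForm α β))⁻¹ • p.rep

theorem eval_chartForm_chartPoint {p : ℙ K (Fin 3 → K)} (hp : eval p.rep (chartForm α β) ≠ 0) :
    eval (chartPoint α β p) (chartForm α β) = 1 := by
  rw [chartPoint, eval_smul_of_isHomogeneous (chartForm_isHomogeneous α β), pow_one,
    inv_mul_cancel₀ hp]

theorem rep_eq_smul_chartPoint {p : ℙ K (Fin 3 → K)} (hp : eval p.rep (chartForm α β) ≠ 0) :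
    p.rep = eval p.rep (chartForm α β) • chartPoint α β p := by
  rw [chartPoint, smul_inv_smul₀ hp]

theorem chartPoint_mk {v : Fin 3 → K} (hv : v ≠ 0) (h : eval v (chartForm α β) = 1) :
    chartPoint α β (Projectivization.mk K v hv) = v := by
  obtain ⟨a, ha⟩ := Projectivization.exists_smul_eq_mk_rep K v hv
  have ha0 : (a : K) ≠ 0 := a.ne_zero
  rw [chartPoint, ← ha, Units.smul_def,
    eval_smul_of_isHomogeneous (chartForm_isHomogeneous α β), h, pow_one, mul_one,
    inv_smul_smul₀ ha0]

theorem mem_pointIdeal_iff_of_isHomogeneous {p : ℙ K (Fin 3 → K)}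
    (hp : eval p.rep (chartForm α β) ≠ 0) {F : MvPolynomial (Fin 3) K} {n : ℕ}
    (hF : F.IsHomogeneous n) : F ∈ pointIdeal p ↔ eval (chartPoint α β p) F = 0 := by
  rw [mem_pointIdeal]
  constructor
  · intro h
    refine h _ ?_
    rw [p.submodule_eq]
    exact Submodule.smul_mem _ _ (Submodule.mem_span_singleton_self _)
  · intro h w hw
    rw [p.submodule_eq, Submodule.mem_span_singleton] at hw
    obtain ⟨t, rfl⟩ := hw
    rw [rep_eq_smul_chartPoint hp, smul_smul, eval_smul_of_isHomogeneous hF, h, mul_zero]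

theorem eval_rep_eq_zero_iff_of_isHomogeneous {p : ℙ K (Fin 3 → K)}
    (hp : eval p.rep (chartForm α β) ≠ 0) {F : MvPolynomial (Fin 3) K} {n : ℕ}
    (hF : F.IsHomogeneous n) : eval p.rep F = 0 ↔ eval (chartPoint α β p) F = 0 := by
  rw [rep_eq_smul_chartPoint hp, eval_smul_of_isHomogeneous hF,
    mul_eq_zero_iff_left (pow_ne_zero _ hp)]

theorem eval_eq_of_dvd {p : ℙ K (Fin 3 → K)} (hp : eval p.rep (chartForm α β) ≠ 0)
    {f g : MvPolynomial (Fin 3) K} (h : chartForm α β - 1 ∣ f - g) :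
    eval (chartPoint α β p) f = eval (chartPoint α β p) g := by
  obtain ⟨q, hq⟩ := h
  rw [← sub_eq_zero, ← map_sub, hq, map_mul, map_sub, eval_chartForm_chartPoint hp, map_one,
    sub_self, zero_mul]

end Points

/-! ### The local rings of the projective plane in terms of the affine chart -/

section LocalRing

variable {K : Type*} [Field K] [Infinite K] (α β : K) (p : ℙ K (Fin 3 → K))

theorem chartForm_mem_primeCompl (hp : eval p.rep (chartForm α β) ≠ 0) :
    chartForm α β ∈ (pointIdeal p).primeCompl := fun h => by
  have := (mem_pointIdeal_iff_of_isHomogeneous hp (chartForm_isHomogeneous α β)).1 h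
  rw [eval_chartForm_chartPoint hp] at this
  exact one_ne_zero this

/-- Dehomogenization: the ring homomorphism to the local ring at `p` sending each coordinate to
its quotient by the linear form `z - α x - β y`. -/
def dehomogenize (hp : eval p.rep (chartForm α β) ≠ 0) :
    MvPolynomial (Fin 3) K →+* LocalRingAt p :=
  eval₂Hom ((HomogeneousLocalization.fromZeroRingHom (homogeneousSubmodule (Fin 3) K)
      (pointIdeal p).primeCompl).comp (algebraMap K (homogeneousSubmodule (Fin 3) K 0)))
    fun i => HomogeneousLocalization.mk
      { deg := 1
        num := ⟨X i, isHomogeneous_X K i⟩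
        den := ⟨chartForm α β, chartForm_isHomogeneous α β⟩
        den_mem := chartForm_mem_primeCompl α β p hp }

variable {α β p}

theorem val_dehomogenize_mul_pow (hp : eval p.rep (chartForm α β) ≠ 0)
    {F : MvPolynomial (Fin 3) K} {n : ℕ} (hF : F.IsHomogeneous n) :
    (dehomogenize α β p hp F).val *
        algebraMap _ (Localization.AtPrime (pointIdeal p)) (chartForm α β) ^ n =
      algebraMap _ (Localization.AtPrime (pointIdeal p)) F := by
  refine map_mul_pow_eq_of_isHomogeneous
    ((algebraMap (LocalRingAt p) (Localization.AtPrime (pointIdeal p))).comp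
      (dehomogenize α β p hp)) (algebraMap _ _) _ (fun r => ?_) (fun i => ?_) hF
  · rw [RingHom.comp_apply, dehomogenize, coe_eval₂Hom, eval₂_C]
    rw [HomogeneousLocalization.algebraMap_apply]
    exact Localization.mk_one_eq_algebraMap _
  · rw [RingHom.comp_apply, dehomogenize, coe_eval₂Hom, eval₂_X]
    rw [HomogeneousLocalization.algebraMap_apply, HomogeneousLocalization.val_mk,
      Localization.mk_eq_mk']
    exact IsLocalization.mk'_spec _ _ (⟨_, chartForm_mem_primeCompl α β p hp⟩ :
      (pointIdeal p).primeCompl)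

theorem isUnit_algebraMap_chartForm (hp : eval p.rep (chartForm α β) ≠ 0) :
    IsUnit (algebraMap _ (Localization.AtPrime (pointIdeal p)) (chartForm α β)) :=
  IsLocalization.map_units _ (⟨_, chartForm_mem_primeCompl α β p hp⟩ : (pointIdeal p).primeCompl)

theorem dehomogenize_chartForm (hp : eval p.rep (chartForm α β) ≠ 0) :
    dehomogenize α β p hp (chartForm α β) = 1 := by
  refine HomogeneousLocalization.val_injective _ ?_
  have := val_dehomogenize_mul_pow hp (chartForm_isHomogeneous α β)
  rw [pow_one] at this
  rw [HomogeneousLocalization.val_one]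
  exact (isUnit_algebraMap_chartForm hp).mul_left_injective (this.trans (one_mul _).symm)

theorem dehomogenize_eq_of_dvd (hp : eval p.rep (chartForm α β) ≠ 0)
    {f g : MvPolynomial (Fin 3) K} (h : chartForm α β - 1 ∣ f - g) :
    dehomogenize α β p hp f = dehomogenize α β p hp g := by
  obtain ⟨q, hq⟩ := h
  rw [← sub_eq_zero, ← map_sub, hq, map_mul, map_sub, dehomogenize_chartForm, map_one, sub_self,
    zero_mul]

theorem isUnit_dehomogenize_of_isHomogeneous (hp : eval p.rep (chartForm α β) ≠ 0)
    {G : MvPolynomial (Fin 3) K} {n : ℕ} (hG : G.IsHomogeneous n)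
    (h : eval (chartPoint α β p) G ≠ 0) : IsUnit (dehomogenize α β p hp G) := by
  rw [← HomogeneousLocalization.isUnit_iff_isUnit_val]
  refine isUnit_of_mul_isUnit_left (y :=
    algebraMap _ (Localization.AtPrime (pointIdeal p)) (chartForm α β) ^ n) ?_
  rw [val_dehomogenize_mul_pow hp hG]
  refine IsLocalization.map_units _ (⟨G, fun hG' => h ?_⟩ : (pointIdeal p).primeCompl)
  exact (mem_pointIdeal_iff_of_isHomogeneous hp hG).1 hG'

theorem isUnit_dehomogenize (hp : eval p.rep (chartForm α β) ≠ 0)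
    {g : MvPolynomial (Fin 3) K} (h : eval (chartPoint α β p) g ≠ 0) :
    IsUnit (dehomogenize α β p hp g) := by
  obtain ⟨G, hG, hd⟩ := exists_form_sub_dvd α β g le_rfl
  rw [← dehomogenize_eq_of_dvd hp hd]
  exact isUnit_dehomogenize_of_isHomogeneous hp hG (by rwa [eval_eq_of_dvd hp hd])

theorem exists_mul_dehomogenize_eq (hp : eval p.rep (chartForm α β) ≠ 0) (q : LocalRingAt p) :
    ∃ f g, eval (chartPoint α β p) g ≠ 0 ∧
      q * dehomogenize α β p hp g = dehomogenize α β p hp f := by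
  have hF : q.num.IsHomogeneous q.deg := q.num_mem_deg
  have hG : q.den.IsHomogeneous q.deg := q.den_mem_deg
  refine ⟨q.num, q.den, fun h => q.den_mem ((mem_pointIdeal_iff_of_isHomogeneous hp hG).2 h),
    HomogeneousLocalization.val_injective _ ?_⟩
  refine ((isUnit_algebraMap_chartForm hp).pow q.deg).mul_left_injective ?_
  beta_reduce
  rw [HomogeneousLocalization.val_mul, mul_assoc, val_dehomogenize_mul_pow hp hF,
    val_dehomogenize_mul_pow hp hG, ← q.den_smul_val, Algebra.smul_def, mul_comm]

variable {J : Ideal (MvPolynomial (Fin 3) K)}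

theorem dehomogenize_mem_stalkIdeal (hp : eval p.rep (chartForm α β) ≠ 0)
    (hJ : J.IsHomogeneous (homogeneousSubmodule (Fin 3) K)) {f : MvPolynomial (Fin 3) K}
    (hf : f ∈ J) : dehomogenize α β p hp f ∈ stalkIdeal J p := by
  rw [← sum_homogeneousComponent f, map_sum]
  refine Ideal.sum_mem _ fun i _ => ?_
  have h := val_dehomogenize_mul_pow hp (homogeneousComponent_isHomogeneous i f)
  refine Ideal.mem_comap.2 ?_
  refine (Ideal.mul_unit_mem_iff_mem _ ((isUnit_algebraMap_chartForm hp).pow i)).1 ?_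
  refine h ▸ Ideal.mem_map_of_mem _ (homogeneousComponent_mem_of_mem hJ hf i)

/-- Clearing denominators multiplies the homogenization `F` into `J` by some `G` outside the ideal
of `p`. As `J` and `F` are homogeneous, `G` may be replaced by one of its components, and for a form
membership in that ideal is tested at `chartPoint α β p`. -/
theorem exists_mul_mem_of_dehomogenize_mem (hp : eval p.rep (chartForm α β) ≠ 0)
    (hJ : J.IsHomogeneous (homogeneousSubmodule (Fin 3) K)) {f : MvPolynomial (Fin 3) K}
    (hf : dehomogenize α β p hp f ∈ stalkIdeal J p) :
    ∃ g, eval (chartPoint α β p) g ≠ 0 ∧ g * f ∈ chartIdeal J α β := by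
  obtain ⟨F, hF, hd⟩ := exists_form_sub_dvd α β f le_rfl
  rw [← dehomogenize_eq_of_dvd hp hd] at hf
  have hF' : algebraMap _ (Localization.AtPrime (pointIdeal p)) F ∈
      J.map (algebraMap _ (Localization.AtPrime (pointIdeal p))) := by
    rw [← val_dehomogenize_mul_pow hp hF]
    exact Ideal.mul_mem_right _ _ (Ideal.mem_comap.1 hf)
  obtain ⟨G, hG, hGF⟩ := (IsLocalization.algebraMap_mem_map_algebraMap_iff
    (pointIdeal p).primeCompl (Localization.AtPrime (pointIdeal p)) J F).1 hF'
  obtain ⟨i, hi⟩ : ∃ i, homogeneousComponent i G ∉ pointIdeal p := by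
    by_contra! h
    refine hG ?_
    rw [← sum_homogeneousComponent G]
    exact Ideal.sum_mem _ fun i _ => h i
  refine ⟨homogeneousComponent i G, fun h => hi ?_, ?_⟩
  · exact (mem_pointIdeal_iff_of_isHomogeneous hp (homogeneousComponent_isHomogeneous i G)).2 h
  · have h1 : homogeneousComponent i G * F ∈ J := by
      have := homogeneousComponent_mem_of_mem hJ hGF (f.totalDegree + i)
      rwa [mul_comm, homogeneousComponent_mul_add hF, mul_comm] at this
    have h2 : homogeneousComponent i G * f =
        homogeneousComponent i G * F - homogeneousComponent i G * (F - f) := by ring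
    rw [h2]
    refine Ideal.sub_mem _ (le_chartIdeal J α β h1) (Ideal.mul_mem_left _ _ ?_)
    exact Ideal.mem_of_dvd _ hd (chartForm_sub_one_mem J α β)

end LocalRing

/-! ### The points of a finite subscheme and the maximal ideals of its coordinate ring -/

section Zeros

variable {K : Type*} [Field K]

/-- The zeros in the projective plane of a homogeneous ideal. -/
def zeros (J : Ideal (MvPolynomial (Fin 3) K)) : Set (ℙ K (Fin 3 → K)) :=
  {p | ∀ f ∈ J, eval p.rep f = 0}

variable {J : Ideal (MvPolynomial (Fin 3) K)} {α β : K} {p : ℙ K (Fin 3 → K)}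

theorem eval_chartPoint_eq_zero (hJ : J.IsHomogeneous (homogeneousSubmodule (Fin 3) K))
    (hp : eval p.rep (chartForm α β) ≠ 0) (hpJ : p ∈ zeros J) {f : MvPolynomial (Fin 3) K}
    (hf : f ∈ chartIdeal J α β) : eval (chartPoint α β p) f = 0 := by
  have hle : chartIdeal J α β ≤ RingHom.ker (eval (chartPoint α β p)) := by
    refine sup_le (fun g hg => ?_) ?_
    · rw [RingHom.mem_ker, ← sum_homogeneousComponent g, map_sum]
      refine Finset.sum_eq_zero fun i _ => ?_
      rw [← eval_rep_eq_zero_iff_of_isHomogeneous hp (homogeneousComponent_isHomogeneous i g)]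
      exact hpJ _ (homogeneousComponent_mem_of_mem hJ hg i)
    · rw [Ideal.span_singleton_le_iff_mem, RingHom.mem_ker, map_sub,
        eval_chartForm_chartPoint hp, map_one, sub_self]
  exact hle hf

/-- Evaluation at a point, on the coordinate ring of the affine chart. -/
def chartEval (hJ : J.IsHomogeneous (homogeneousSubmodule (Fin 3) K))
    (hp : eval p.rep (chartForm α β) ≠ 0) (hpJ : p ∈ zeros J) :
    (MvPolynomial (Fin 3) K ⧸ chartIdeal J α β) →+* K :=
  Ideal.Quotient.lift _ (eval (chartPoint α β p)) fun _ hf => eval_chartPoint_eq_zero hJ hp hpJ hf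

@[simp] theorem chartEval_mk (hJ : J.IsHomogeneous (homogeneousSubmodule (Fin 3) K))
    (hp : eval p.rep (chartForm α β) ≠ 0) (hpJ : p ∈ zeros J) (f : MvPolynomial (Fin 3) K) :
    chartEval hJ hp hpJ (Ideal.Quotient.mk _ f) = eval (chartPoint α β p) f := rfl

/-- The maximal ideal of a point in the coordinate ring of the affine chart. -/
def chartMaximal (hJ : J.IsHomogeneous (homogeneousSubmodule (Fin 3) K))
    (hp : eval p.rep (chartForm α β) ≠ 0) (hpJ : p ∈ zeros J) :
    MaximalSpectrum (MvPolynomial (Fin 3) K ⧸ chartIdeal J α β) :=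
  ⟨RingHom.ker (chartEval hJ hp hpJ), RingHom.ker_isMaximal_of_surjective _ fun a =>
    ⟨Ideal.Quotient.mk _ (C a), by simp⟩⟩

theorem mk_mem_chartMaximal_iff (hJ : J.IsHomogeneous (homogeneousSubmodule (Fin 3) K))
    (hp : eval p.rep (chartForm α β) ≠ 0) (hpJ : p ∈ zeros J) {f : MvPolynomial (Fin 3) K} :
    Ideal.Quotient.mk _ f ∈ (chartMaximal hJ hp hpJ).asIdeal ↔
      eval (chartPoint α β p) f = 0 := Iff.rfl

theorem chartForm_ne_zero_of_mem_zeros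
    (hV : ∀ v, (∀ f ∈ J, eval v f = 0) → eval v (chartForm α β) = 0 → v = 0)
    (hpJ : p ∈ zeros J) : eval p.rep (chartForm α β) ≠ 0 := fun h =>
  p.rep_nonzero (hV _ hpJ h)

/-- The line at infinity misses the zeros of `J`, so all of them are seen in the chart; surjectivity
is the Nullstellensatz. -/
theorem chartMaximal_bijective [IsAlgClosed K]
    (hJ : J.IsHomogeneous (homogeneousSubmodule (Fin 3) K))
    (hV : ∀ v, (∀ f ∈ J, eval v f = 0) → eval v (chartForm α β) = 0 → v = 0) :
    Function.Bijective fun p : zeros J =>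
      chartMaximal hJ (chartForm_ne_zero_of_mem_zeros hV p.2) p.2 := by
  constructor
  · rintro ⟨p, hp⟩ ⟨q, hq⟩ hpq
    have hp' := chartForm_ne_zero_of_mem_zeros hV hp
    have hq' := chartForm_ne_zero_of_mem_zeros hV hq
    have hw : chartPoint α β p = chartPoint α β q := funext fun i => by
      have h1 := (mk_mem_chartMaximal_iff hJ hp' hp
        (f := X i - C (chartPoint α β p i))).2 (by simp)
      have h2 : Ideal.Quotient.mk (chartIdeal J α β) (X i - C (chartPoint α β p i)) ∈
          (chartMaximal hJ hq' hq).asIdeal := by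
        rw [← congrArg MaximalSpectrum.asIdeal hpq]
        exact h1
      have := (mk_mem_chartMaximal_iff hJ hq' hq).1 h2
      rw [map_sub, eval_X, eval_C, sub_eq_zero] at this
      exact this.symm
    refine Subtype.ext ?_
    change p = q
    rw [← p.mk_rep, ← q.mk_rep, Projectivization.mk_eq_mk_iff']
    refine ⟨eval p.rep (chartForm α β) * (eval q.rep (chartForm α β))⁻¹, ?_⟩
    rw [mul_smul]
    change _ • chartPoint α β q = _
    rw [← hw, ← rep_eq_smul_chartPoint hp']
  · intro m
    have hm : (m.asIdeal.comap (Ideal.Quotient.mk (chartIdeal J α β))).IsMaximal :=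
      Ideal.comap_isMaximal_of_surjective _ Ideal.Quotient.mk_surjective (H := m.isMaximal)
    obtain ⟨v, hv⟩ := isMaximal_iff_eq_vanishingIdeal_singleton.1 hm
    have hmem : ∀ f, Ideal.Quotient.mk (chartIdeal J α β) f ∈ m.asIdeal ↔ eval v f = 0 :=
      fun f => by
        rw [← Ideal.mem_comap, hv, mem_vanishingIdeal_singleton_iff, aeval_eq_eval]
    have hI : ∀ f ∈ chartIdeal J α β, eval v f = 0 := fun f hf => by
      rw [← hmem, Ideal.Quotient.eq_zero_iff_mem.2 hf]
      exact zero_mem _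
    have hl : eval v (chartForm α β) = 1 := by
      have := hI _ (chartForm_sub_one_mem J α β)
      rwa [map_sub, map_one, sub_eq_zero] at this
    have hv0 : v ≠ 0 := by
      rintro rfl
      simp [chartForm] at hl
    have hpt : chartPoint α β (Projectivization.mk K v hv0) = v := chartPoint_mk hv0 hl
    have hpJ : Projectivization.mk K v hv0 ∈ zeros J := fun f hf => by
      obtain ⟨a, ha⟩ := Projectivization.exists_smul_eq_mk_rep K v hv0
      rw [← ha, ← sum_homogeneousComponent f, map_sum]
      refine Finset.sum_eq_zero fun i _ => ?_
      rw [Units.smul_def, eval_smul_of_isHomogeneous (homogeneousComponent_isHomogeneous i f),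
        hI _ (le_chartIdeal _ _ _ (homogeneousComponent_mem_of_mem hJ hf i)), mul_zero]
    refine ⟨⟨_, hpJ⟩, MaximalSpectrum.ext (Ideal.ext fun a => ?_)⟩
    obtain ⟨f, rfl⟩ := Ideal.Quotient.mk_surjective a
    rw [mk_mem_chartMaximal_iff, hpt, hmem]

end Zeros

/-! ### Stalks as localizations of the chart ring, and the sum of their lengths -/

section LengthSum

variable {K : Type*} [Field K] [Infinite K] {J : Ideal (MvPolynomial (Fin 3) K)} {α β : K}
  {p : ℙ K (Fin 3 → K)}

/-- The homomorphism from the coordinate ring of the affine chart to the local ring at `p` of the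
scheme defined by `J`. -/
def chartToStalk (hJ : J.IsHomogeneous (homogeneousSubmodule (Fin 3) K))
    (hp : eval p.rep (chartForm α β) ≠ 0) :
    (MvPolynomial (Fin 3) K ⧸ chartIdeal J α β) →+* LocalRingAt p ⧸ stalkIdeal J p :=
  Ideal.Quotient.lift _ ((Ideal.Quotient.mk (stalkIdeal J p)).comp (dehomogenize α β p hp))
    fun f hf => by
      have hle : chartIdeal J α β ≤ RingHom.ker
          ((Ideal.Quotient.mk (stalkIdeal J p)).comp (dehomogenize α β p hp)) := by
        refine sup_le (fun g hg => ?_) ?_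
        · exact Ideal.Quotient.eq_zero_iff_mem.2 (dehomogenize_mem_stalkIdeal hp hJ hg)
        · rw [Ideal.span_singleton_le_iff_mem, RingHom.mem_ker, map_sub, RingHom.comp_apply,
            dehomogenize_chartForm, map_one, map_one, sub_self]
      exact hle hf

theorem isLocalization_chartToStalk (hJ : J.IsHomogeneous (homogeneousSubmodule (Fin 3) K))
    (hp : eval p.rep (chartForm α β) ≠ 0) (hpJ : p ∈ zeros J) :
    letI := (chartToStalk hJ hp).toAlgebra
    IsLocalization.AtPrime (LocalRingAt p ⧸ stalkIdeal J p) (chartMaximal hJ hp hpJ).asIdeal := by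
  let _ := (chartToStalk hJ hp).toAlgebra
  refine (isLocalization_iff _ _).2 ⟨?_, ?_, ?_⟩
  · rintro ⟨a, ha⟩
    obtain ⟨f, rfl⟩ := Ideal.Quotient.mk_surjective a
    exact (isUnit_dehomogenize hp fun h => ha ((mk_mem_chartMaximal_iff hJ hp hpJ).2 h)).map
      (Ideal.Quotient.mk (stalkIdeal J p))
  · intro z
    obtain ⟨q, rfl⟩ := Ideal.Quotient.mk_surjective z
    obtain ⟨f, g, hg, hq⟩ := exists_mul_dehomogenize_eq hp q
    refine ⟨(Ideal.Quotient.mk _ f, ⟨Ideal.Quotient.mk _ g, fun h =>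
      hg ((mk_mem_chartMaximal_iff hJ hp hpJ).1 h)⟩), ?_⟩
    exact (map_mul (Ideal.Quotient.mk (stalkIdeal J p)) _ _).symm.trans
      (congrArg (Ideal.Quotient.mk (stalkIdeal J p)) hq)
  · intro a b hab
    obtain ⟨f, rfl⟩ := Ideal.Quotient.mk_surjective a
    obtain ⟨g, rfl⟩ := Ideal.Quotient.mk_surjective b
    have h : dehomogenize α β p hp (f - g) ∈ stalkIdeal J p := by
      rw [map_sub]
      exact Ideal.Quotient.eq.1 hab
    obtain ⟨s, hs, hsm⟩ := exists_mul_mem_of_dehomogenize_mem hp hJ h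
    refine ⟨⟨Ideal.Quotient.mk _ s, fun h => hs ((mk_mem_chartMaximal_iff hJ hp hpJ).1 h)⟩, ?_⟩
    change Ideal.Quotient.mk (chartIdeal J α β) s * _ = Ideal.Quotient.mk _ s * _
    rw [← map_mul, ← map_mul, Ideal.Quotient.eq, ← mul_sub]
    exact hsm

end LengthSum

theorem finsum_length_eq_finrank {K : Type*} [Field K] [IsAlgClosed K]
    {J : Ideal (MvPolynomial (Fin 3) K)} {α β : K}
    (hJ : J.IsHomogeneous (homogeneousSubmodule (Fin 3) K))
    (hV : ∀ v, (∀ f ∈ J, eval v f = 0) → eval v (chartForm α β) = 0 → v = 0)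
    [Module.Finite K (MvPolynomial (Fin 3) K ⧸ chartIdeal J α β)] :
    ∑ᶠ p ∈ zeros J, Module.length (LocalRingAt p) (LocalRingAt p ⧸ stalkIdeal J p) =
      Module.finrank K (MvPolynomial (Fin 3) K ⧸ chartIdeal J α β) := by
  have : IsArtinianRing (MvPolynomial (Fin 3) K ⧸ chartIdeal J α β) :=
    IsArtinianRing.of_finite K _
  have := Fintype.ofFinite (MaximalSpectrum (MvPolynomial (Fin 3) K ⧸ chartIdeal J α β))
  rw [← finsum_set_coe_eq_finsum_mem, ← sum_length_localization, ← finsum_eq_sum_of_fintype]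
  refine finsum_eq_of_bijective _ (chartMaximal_bijective hJ hV) fun p => ?_
  have hp := chartForm_ne_zero_of_mem_zeros hV p.2
  let _ := (chartToStalk hJ hp).toAlgebra
  have := isLocalization_chartToStalk hJ hp p.2
  exact length_eq_length_localization (R := MvPolynomial (Fin 3) K ⧸ chartIdeal J α β)
    Ideal.Quotient.mk_surjective _

/-! ### The critical scheme -/

section Critical

variable {K : Type*} [Field K]

/-- The mixed second derivatives of `B`. -/
def mixedPartials (B : MvPolynomial (Fin 3) K) : Fin 3 → MvPolynomial (Fin 3) K :=
  ![pderiv 1 (pderiv 2 B), pderiv 0 (pderiv 2 B), pderiv 0 (pderiv 1 B)]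

theorem pderiv_isHomogeneous {B : MvPolynomial (Fin 3) K} {n : ℕ} (hB : B.IsHomogeneous n)
    (i : Fin 3) : (pderiv i B).IsHomogeneous (n - 1) := hB.pderiv

theorem mixedPartials_isHomogeneous {B : MvPolynomial (Fin 3) K} {c : ℕ}
    (hB : B.IsHomogeneous (c + 2)) (i : Fin 3) : (mixedPartials B i).IsHomogeneous c := by
  have h : ∀ i j, (pderiv i (pderiv j B)).IsHomogeneous c := fun i j =>
    pderiv_isHomogeneous (pderiv_isHomogeneous hB j) i
  fin_cases i
  exacts [h 1 2, h 0 2, h 0 1]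

/-- The commutator is a derivation that kills the variables. -/
theorem pderiv_comm {R σ : Type*} [CommRing R] (i j : σ) (f : MvPolynomial σ R) :
    pderiv i (pderiv j f) = pderiv j (pderiv i f) := by
  classical
  have h : ⁅(pderiv i : Derivation R (MvPolynomial σ R) (MvPolynomial σ R)),
      (pderiv j : Derivation R (MvPolynomial σ R) (MvPolynomial σ R))⁆ = 0 := by
    refine derivation_ext fun k => ?_
    rw [Derivation.commutator_apply, pderiv_X, pderiv_X]
    simp only [Pi.single_apply]
    split_ifs <;> simp
  rw [← sub_eq_zero, ← Derivation.commutator_apply, h, Derivation.zero_apply]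

/-- Differentiating twice multiplies a coefficient by two consecutive integers, one of which is
even. -/
theorem pderiv_pderiv_self {R σ : Type*} [CommRing R] [CharP R 2] (i : σ)
    (f : MvPolynomial σ R) : pderiv i (pderiv i f) = 0 := by
  ext m
  rw [coeff_pderiv, coeff_pderiv, coeff_zero, mul_assoc]
  have h : (((m + Finsupp.single i 1 : σ →₀ ℕ) i : R) + 1) * (m i + 1) = 0 := by
    have h2 : (2 : R) = 0 := CharTwo.two_eq_zero
    obtain ⟨k, hk⟩ : 2 ∣ (m i + 1 + 1) * (m i + 1) := by
      rw [mul_comm]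
      exact (Nat.even_mul_succ_self _).two_dvd
    have := congrArg (Nat.cast (R := R)) hk
    push_cast at this
    simpa [h2] using this
  rw [h, mul_zero]

/-- Euler's formula for `pderiv i B`, whose degree `d - 1` is 1 in `K`; the diagonal Hessian term
drops out. -/
theorem gradient_eq_minors [CharP K 2] {B : MvPolynomial (Fin 3) K} {d : ℕ} (hd : Even d)
    (hd2 : 2 ≤ d) (hB : B.IsHomogeneous d) (i : Fin 3) :
    pderiv i B = minors (mixedPartials B) i := by
  have hodd : (((d - 1 : ℕ) : MvPolynomial (Fin 3) K)) = 1 := by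
    obtain ⟨k, rfl⟩ := hd
    rw [show k + k - 1 = 2 * (k - 1) + 1 by omega]
    push_cast
    rw [two_eq_zero_mvPolynomial, zero_mul, zero_add]
  have he := (pderiv_isHomogeneous hB i).sum_X_mul_pderiv
  rw [nsmul_eq_mul, hodd, one_mul, Fin.sum_univ_three] at he
  rw [← he]
  fin_cases i
  · simp [minors, mixedPartials, pderiv_pderiv_self, pderiv_comm (1 : Fin 3) 0,
      pderiv_comm (2 : Fin 3) 0]
  · simp [minors, mixedPartials, pderiv_pderiv_self, pderiv_comm (2 : Fin 3) 1]
  · simp [minors, mixedPartials, pderiv_pderiv_self]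

theorem gradientIdeal_eq_minorsIdeal [CharP K 2] {B : MvPolynomial (Fin 3) K} {d : ℕ}
    (hd : Even d) (hd2 : 2 ≤ d) (hB : B.IsHomogeneous d) :
    gradientIdeal B = minorsIdeal (mixedPartials B) := by
  rw [gradientIdeal, minorsIdeal, funext (gradient_eq_minors hd hd2 hB)]

theorem forall_mem_minorsIdeal_eval {P : Fin 3 → MvPolynomial (Fin 3) K} {v : Fin 3 → K} :
    (∀ f ∈ minorsIdeal P, eval v f = 0) ↔ ∀ i, eval v (minors P i) = 0 := by
  have : minorsIdeal P ≤ RingHom.ker (eval v) ↔ _ := Ideal.span_le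
  refine this.trans ?_
  rw [Set.range_subset_iff]
  rfl

theorem criticalLocus_eq_zeros [CharP K 2] {B : MvPolynomial (Fin 3) K} {d : ℕ}
    (hd : Even d) (hd2 : 2 ≤ d) (hB : B.IsHomogeneous d) :
    criticalLocus B = zeros (minorsIdeal (mixedPartials B)) := by
  ext p
  refine Iff.trans ?_ forall_mem_minorsIdeal_eval.symm
  exact forall_congr' fun i => by rw [gradient_eq_minors hd hd2 hB]

theorem exists_chartForm_ne_zero [Infinite K] {Z : Set (ℙ K (Fin 3 → K))} (hZ : Z.Finite) :
    ∃ α β : K, ∀ p ∈ Z, eval p.rep (chartForm α β) ≠ 0 := by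
  -- First `β` avoids the points with `x = 0`, then `α` avoids the others; division by zero only
  -- adds harmless excluded values.
  obtain ⟨β, hβ⟩ := (hZ.image fun p => p.rep 2 / p.rep 1).exists_notMem
  obtain ⟨α, hα⟩ := (hZ.image fun p => (p.rep 2 - β * p.rep 1) / p.rep 0).exists_notMem
  refine ⟨α, β, fun p hp h => ?_⟩
  have h' : p.rep 2 - β * p.rep 1 = α * p.rep 0 := by
    simp only [chartForm, map_sub, map_add, map_mul, eval_X, eval_C] at h
    linear_combination h
  by_cases h0 : p.rep 0 = 0
  · rw [h0, mul_zero, sub_eq_zero] at h'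
    by_cases h1 : p.rep 1 = 0
    · refine p.rep_nonzero (funext fun i => ?_)
      rw [h1, mul_zero] at h'
      fin_cases i <;> assumption
    · exact hβ ⟨p, hp, by simp only [h']; field_simp⟩
  · exact hα ⟨p, hp, by simp only [h']; field_simp⟩

theorem criticalLength_eq [IsAlgClosed K] [CharP K 2] {B : MvPolynomial (Fin 3) K} {c : ℕ}
    (hd : Even (c + 2)) (hB : B.IsHomogeneous (c + 2)) (hfin : (criticalLocus B).Finite) :
    criticalLength B = ((c + 1) * c + 1 : ℕ) := by
  have hP := mixedPartials_isHomogeneous hB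
  have hZ := criticalLocus_eq_zeros hd (by omega) hB
  obtain ⟨α, β, h⟩ := exists_chartForm_ne_zero hfin
  have hV : ∀ v, (∀ i, eval v (minors (mixedPartials B) i) = 0) →
      eval v (chartForm α β) = 0 → v = 0 := fun v hv hl => by
    by_contra hv0
    obtain ⟨a, ha⟩ := Projectivization.exists_smul_eq_mk_rep K v hv0
    refine h (Projectivization.mk K v hv0) ?_ ?_
    · rw [hZ]
      refine forall_mem_minorsIdeal_eval.2 fun i => ?_
      rw [← ha, Units.smul_def, eval_smul_of_isHomogeneous (minors_isHomogeneous hP i), hv,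
        mul_zero]
    · rw [← ha, Units.smul_def, eval_smul_of_isHomogeneous (chartForm_isHomogeneous α β), hl,
        mul_zero]
  obtain ⟨hR, hrank⟩ := finite_and_finrank_chart hP hV
  rw [criticalLength, gradientIdeal_eq_minorsIdeal hd (by omega) hB, hZ,
    finsum_length_eq_finrank (minorsIdeal_isHomogeneous hP)
      (fun v hv => hV v (forall_mem_minorsIdeal_eval.1 hv)), hrank]

end Critical

/-! ### Reducedness of the critical scheme -/

section Reduced

variable {K : Type*} [Field K]

/-- A reduced Artinian ring is the product of its residue fields, here all equal to `K`. -/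
theorem finrank_eq_card_maximalSpectrum [IsAlgClosed K] (R : Type*) [CommRing R] [Algebra K R]
    [Module.Finite K R] [IsReduced R] : Module.finrank K R = Nat.card (MaximalSpectrum R) := by
  have : IsArtinianRing R := IsArtinianRing.of_finite K R
  have := Fintype.ofFinite (MaximalSpectrum R)
  have h1 (m : MaximalSpectrum R) : Module.finrank K (R ⧸ m.asIdeal) = 1 := by
    have := m.isMaximal
    have hb : Function.Bijective (algebraMap K (R ⧸ m.asIdeal)) :=
      IsAlgClosed.algebraMap_bijective_of_isIntegral
    rw [← (LinearEquiv.ofBijective (Algebra.linearMap K (R ⧸ m.asIdeal)) hb).finrank_eq,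
      Module.finrank_self]
  rw [((IsArtinianRing.equivPi R).restrictScalars K).toLinearEquiv.finrank_eq,
    Module.finrank_pi_fintype, Finset.sum_congr rfl fun m _ => h1 m]
  simp

theorem one_mem_span_of_no_zeros [IsAlgClosed K] {σ : Type*} [Finite σ] {s : Set (MvPolynomial σ K)}
    (hs : ∀ v : σ → K, ¬ ∀ f ∈ s, eval v f = 0) : (1 : MvPolynomial σ K) ∈ Ideal.span s := by
  rw [← Ideal.eq_top_iff_one, ← Ideal.radical_eq_top,
    ← vanishingIdeal_zeroLocus_eq_radical (K := K), Ideal.eq_top_iff_one, mem_vanishingIdeal_iff]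
  intro v hv
  exact absurd (fun f hf => by simpa [aeval_eq_eval] using hv f (Ideal.subset_span hf)) (hs v)

theorem derivation_apply_eq_sum {R M : Type*} [CommRing R] [Algebra K R] [AddCommGroup M]
    [Module K M] [Module R M] (D : Derivation K R M)
    (π : MvPolynomial (Fin 3) K →ₐ[K] R) (f : MvPolynomial (Fin 3) K) :
    D (π f) = ∑ i, π (pderiv i f) • D (π (X i)) := by
  induction f using MvPolynomial.induction_on with
  | C a =>
    rw [← algebraMap_eq, AlgHom.commutes, Derivation.map_algebraMap]
    simp [algebraMap_eq]
  | add f g hf hg => simp only [map_add, hf, hg, add_smul, Finset.sum_add_distrib]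
  | mul_X f i hf =>
    rw [map_mul, Derivation.leibniz, hf]
    simp only [pderiv_mul, map_add, map_mul, add_smul, Finset.sum_add_distrib, pderiv_X]
    rw [add_comm, Finset.smul_sum]
    congr 1
    · refine Finset.sum_congr rfl fun j _ => ?_
      rw [smul_smul, mul_comm]
    · rw [Finset.sum_eq_single i]
      · simp
      · intro j _ hj
        simp [hj.symm]
      · simp

/-- A linear algebra identity behind the smoothness of the critical scheme: a nondegenerate
alternating form in three variables and a nonzero linear form cut out zero. -/
theorem eq_zero_of_alternating {R M : Type*} [CommRing R] [AddCommGroup M] [Module R M]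
    (h2 : (2 : R) = 0) {P : Fin 3 → R} {a b : R} (hQ : IsUnit (P 2 - (a * P 0 + b * P 1)))
    {ω : Fin 3 → M} (d0 : P 2 • ω 1 + P 1 • ω 2 = 0) (d1 : P 2 • ω 0 + P 0 • ω 2 = 0)
    (d2 : P 1 • ω 0 + P 0 • ω 1 = 0) (hl : ω 2 - (a • ω 0 + b • ω 1) = 0) (i : Fin 3) :
    ω i = 0 := by
  have h2ω : ∀ ω : M, (2 : R) • ω = 0 := fun ω => by rw [h2, zero_smul]
  refine hQ.smul_eq_zero.1 ?_
  fin_cases i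
  · simp only [Fin.zero_eta]
    linear_combination (norm := module) d1 - b • d2 + P 0 • hl - P 0 • h2ω (ω 2) +
      (b * P 0) • h2ω (ω 1)
  · simp only [Fin.mk_one]
    linear_combination (norm := module) d0 - a • d2 + P 1 • hl - P 1 • h2ω (ω 2) +
      (a * P 1) • h2ω (ω 0)
  · simp only [Fin.reduceFinMk]
    linear_combination (norm := module) P 2 • hl - a • d1 - b • d0 + (a * P 2) • h2ω (ω 0) +
      (b * P 2) • h2ω (ω 1)

/-- A vector parallel to `x` is `x` times the value on it of a linear form normalized to 1 at `x`.
-/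
theorem eq_mul_of_cross_eq_zero {R : Type*} [CommRing R] (h2 : (2 : R) = 0) {x P : Fin 3 → R}
    {a b : R} (e0 : x 1 * P 2 + x 2 * P 1 = 0) (e1 : x 0 * P 2 + x 2 * P 0 = 0)
    (e2 : x 0 * P 1 + x 1 * P 0 = 0) (hl : x 2 - (a * x 0 + b * x 1) = 1) (i : Fin 3) :
    P i = x i * (P 2 - (a * P 0 + b * P 1)) := by
  fin_cases i
  · simp only [Fin.zero_eta]
    linear_combination (-P 0) * hl + e1 - b * e2 + (-x 0 * P 2 + b * x 0 * P 1) * h2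
  · simp only [Fin.mk_one]
    linear_combination (-P 1) * hl + e0 - a * e2 + (-x 1 * P 2 + a * x 1 * P 0) * h2
  · simp only [Fin.reduceFinMk]
    linear_combination (-P 2) * hl - a * e1 - b * e0 + (a * x 2 * P 0 + b * x 2 * P 1) * h2

variable [IsAlgClosed K] [CharP K 2] {B : MvPolynomial (Fin 3) K} {d : ℕ} {α β : K}

/-- In `R` one has `P = Q * x` with `Q` a unit. Differentiating the equations and `l = 1` gives
linear relations among the `D (π (X i))` that force them to vanish; so the differentials of `R` are
zero, and `R` is unramified over `K`. -/
theorem isReduced_of_mixedPartials {R : Type*} [CommRing R] [Algebra K R]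
    (π : MvPolynomial (Fin 3) K →ₐ[K] R) (hπ : Function.Surjective π)
    (hB : ∀ i, pderiv i B = minors (mixedPartials B) i)
    (hP : ∀ v, (∀ i, eval v (mixedPartials B i) = 0) → v = 0)
    (hA : ∀ i, π (minors (mixedPartials B) i) = 0) (hl : π (chartForm α β) = 1) :
    IsReduced R := by
  set P := mixedPartials B with hPdef
  let a := algebraMap K R α
  let b := algebraMap K R β
  have h2 : (2 : R) = 0 := by
    have := congrArg π (two_eq_zero_mvPolynomial (K := K))
    rwa [map_ofNat, map_zero] at this
  have hl' : π (X 2) - (a * π (X 0) + b * π (X 1)) = 1 := by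
    simpa [chartForm, ← algebraMap_eq] using hl
  have hPQ := eq_mul_of_cross_eq_zero h2 (x := fun i => π (X i)) (P := fun i => π (P i))
    (by simpa [minors] using hA 0) (by simpa [minors] using hA 1) (by simpa [minors] using hA 2)
    hl'
  set Q := π (P 2) - (a * π (P 0) + b * π (P 1)) with hQ
  have hunit : IsUnit Q := by
    -- `P` vanishes only at the origin, where `l ≠ 1`; hence `P` generates the unit ideal of `R`,
    -- and every `P i` is a multiple of `Q`.
    have h1 : (1 : MvPolynomial (Fin 3) K) ∈
        Ideal.span (insert (chartForm α β - 1) (Set.range P)) := by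
      refine one_mem_span_of_no_zeros fun v hv => ?_
      have hv0 := hP v fun i => hv _ (Set.mem_insert_of_mem _ ⟨i, rfl⟩)
      have := hv _ (Set.mem_insert _ _)
      simp [hv0, chartForm] at this
    have hle : Ideal.span (insert (chartForm α β - 1) (Set.range P)) ≤
        (Ideal.span {Q}).comap π := by
      rw [Ideal.span_le]
      rintro _ (rfl | ⟨i, rfl⟩)
      · rw [SetLike.mem_coe, Ideal.mem_comap, map_sub, hl, map_one, sub_self]
        exact zero_mem _
      · rw [SetLike.mem_coe, Ideal.mem_comap, hPQ]
        exact Ideal.mul_mem_left _ _ (Ideal.mem_span_singleton_self Q)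
    have := hle h1
    rw [Ideal.mem_comap, map_one, Ideal.mem_span_singleton] at this
    exact isUnit_of_dvd_one this
  let D := KaehlerDifferential.D K R
  have hdA : ∀ i, ∑ j, π (pderiv j (pderiv i B)) • D (π (X j)) = 0 := fun i => by
    rw [← derivation_apply_eq_sum, hB, hA, map_zero]
  have hω := eq_zero_of_alternating h2 (P := fun i => π (P i)) hunit (ω := fun i => D (π (X i)))
    (by simpa [Fin.sum_univ_three, pderiv_pderiv_self, pderiv_comm (1 : Fin 3) 0,
      pderiv_comm (2 : Fin 3) 0, hPdef, mixedPartials] using hdA 0)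
    (by simpa [Fin.sum_univ_three, pderiv_pderiv_self, pderiv_comm (2 : Fin 3) 1, hPdef,
      mixedPartials] using hdA 1)
    (by simpa [Fin.sum_univ_three, pderiv_pderiv_self, hPdef, mixedPartials] using hdA 2)
    (by
      have := congrArg D hl'
      rw [Derivation.map_one_eq_zero, map_sub, map_add] at this
      simpa [a, b] using this)
  have hD : ∀ r, D r = 0 := fun r => by
    obtain ⟨f, rfl⟩ := hπ r
    rw [derivation_apply_eq_sum]
    exact Finset.sum_eq_zero fun i _ => by rw [hω i, smul_zero]
  have hsub : Subsingleton (Ω[R⁄K]) := by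
    refine (Submodule.subsingleton_iff R).1 (subsingleton_of_bot_eq_top ?_)
    rw [← KaehlerDifferential.span_range_derivation, eq_comm, Submodule.span_eq_bot]
    rintro _ ⟨r, rfl⟩
    exact hD r
  have : Algebra.FormallyUnramified K R := ⟨hsub⟩
  have : Algebra.FiniteType K R := Algebra.FiniteType.of_surjective π hπ
  exact Algebra.FormallyUnramified.isReduced_of_field K R

theorem ncard_criticalLocus (hd : Even d) (hd2 : 2 ≤ d) (hB : B.IsHomogeneous d)
    (hP : ∀ v, (∀ i, eval v (mixedPartials B i) = 0) → v = 0)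
    (hV : ∀ v, (∀ i, eval v (pderiv i B) = 0) → eval v (chartForm α β) = 0 → v = 0) :
    (criticalLocus B).Finite ∧ (criticalLocus B).ncard = (d - 1) * (d - 2) + 1 := by
  obtain ⟨c, rfl⟩ := Nat.exists_eq_add_of_le' hd2
  have hBA := gradient_eq_minors hd hd2 hB
  have hPh := mixedPartials_isHomogeneous hB
  simp only [hBA] at hV
  obtain ⟨hR, hrank⟩ := finite_and_finrank_chart hPh hV
  set I := chartIdeal (minorsIdeal (mixedPartials B)) α β
  have hred : IsReduced (MvPolynomial (Fin 3) K ⧸ I) :=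
    isReduced_of_mixedPartials (Ideal.Quotient.mkₐ K I) (Ideal.Quotient.mkₐ_surjective K I)
      hBA hP (fun i => Ideal.Quotient.eq_zero_iff_mem.2
        (le_chartIdeal _ _ _ (Ideal.subset_span ⟨i, rfl⟩))) (mk_chartForm _ α β)
  have : IsArtinianRing (MvPolynomial (Fin 3) K ⧸ I) := IsArtinianRing.of_finite K _
  have hbij := chartMaximal_bijective (minorsIdeal_isHomogeneous hPh)
    (fun v hv => hV v (forall_mem_minorsIdeal_eval.1 hv))
  rw [criticalLocus_eq_zeros hd hd2 hB]
  refine ⟨Set.finite_coe_iff.1 (Finite.of_injective _ hbij.1), ?_⟩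
  rw [← Nat.card_coe_set_eq, Nat.card_eq_of_bijective _ hbij, ← finrank_eq_card_maximalSpectrum
    (K := K), hrank]
  rfl

end Reduced

/-! ### Openness of the absence of common zeros -/

section Open

variable {K : Type*} [Field K]

/-- The coefficients of `F B` are polynomials in the coefficients of `B`. -/
def DependsPolynomially (F : MvPolynomial (Fin 3) K → MvPolynomial (Fin 3) K) : Prop :=
  ∀ m, ∃ Q : MvPolynomial (Fin 3 →₀ ℕ) K, ∀ B, coeff m (F B) = eval (fun n => coeff n B) Q

theorem dependsPolynomially_id :
    DependsPolynomially (fun B : MvPolynomial (Fin 3) K => B) := fun m =>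
  ⟨X m, fun B => by rw [eval_X]⟩

theorem dependsPolynomially_const (f : MvPolynomial (Fin 3) K) :
    DependsPolynomially fun _ => f := fun m => ⟨C (coeff m f), fun B => by rw [eval_C]⟩

theorem DependsPolynomially.pderiv {F : MvPolynomial (Fin 3) K → MvPolynomial (Fin 3) K}
    (hF : DependsPolynomially F) (i : Fin 3) :
    DependsPolynomially fun B => MvPolynomial.pderiv i (F B) := fun m => by
  obtain ⟨Q, hQ⟩ := hF (m + Finsupp.single i 1)
  exact ⟨Q * C (m i + 1 : K), fun B => by rw [coeff_pderiv, hQ, map_mul, eval_C]⟩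

theorem eval_eq_sum_of_isHomogeneous {f : MvPolynomial (Fin 3) K} {n : ℕ}
    (hf : f.IsHomogeneous n) (v : Fin 3 → K) :
    eval v f = ∑ b : (Finset.univ : Finset (Fin 3)).finsuppAntidiag n,
      coeff b f * ∏ i, v i ^ (b : Fin 3 →₀ ℕ) i := by
  rw [eval_eq', Finset.sum_coe_sort _ fun b => coeff b f * ∏ i, v i ^ b i]
  refine Finset.sum_subset (fun b hb => ?_) fun b _ hb => ?_
  · rw [mem_finsuppAntidiag_univ_iff]
    by_contra h
    exact (mem_support_iff.1 hb) (hf.coeff_eq_zero h)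
  · rw [notMem_support_iff.1 hb, zero_mul]

/-- If the forms `F j B₀` generate all monomials of degree `n`, and the `u a j` are coefficients
expressing these, then the `F j B` have no common zeros when the matrix of the
`∑ j, u a j * F j B` is invertible. -/
theorem eq_zero_of_det_ne_zero {ι : Type*} [Fintype ι] {n : ℕ} {f : ι → MvPolynomial (Fin 3) K}
    {u : (Finset.univ : Finset (Fin 3)).finsuppAntidiag n → ι → MvPolynomial (Fin 3) K}
    (hu : ∀ a, (∑ j, u a j * f j).IsHomogeneous n)
    (hdet : (Matrix.of fun a b : (Finset.univ : Finset (Fin 3)).finsuppAntidiag n =>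
      coeff b (∑ j, u a j * f j)).det ≠ 0) {v : Fin 3 → K} (hv : ∀ j, eval v (f j) = 0) :
    v = 0 := by
  -- The values at `v` of all monomials of degree `n` form a vector in the kernel of the matrix.
  have hw := Matrix.eq_zero_of_mulVec_eq_zero hdet (v := fun b => ∏ i, v i ^ (b : Fin 3 →₀ ℕ) i)
    (funext fun a => by
      have := eval_eq_sum_of_isHomogeneous (hu a) v
      rw [map_sum, Finset.sum_eq_zero fun j _ => by rw [map_mul, hv, mul_zero]] at this
      exact this.symm)
  funext i
  have hmem : Finsupp.single i n ∈ (Finset.univ : Finset (Fin 3)).finsuppAntidiag n := by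
    rw [mem_finsuppAntidiag_univ_iff, Finsupp.degree_single]
  have := congrFun hw ⟨_, hmem⟩
  rw [Finset.prod_eq_single i (fun j _ hj => by
    rw [Finsupp.single_eq_of_ne hj, pow_zero]) (by simp), Finsupp.single_eq_same] at this
  exact eq_zero_of_pow_eq_zero this

theorem exists_monomial_combination [IsAlgClosed K] {ι : Type*} [Fintype ι]
    {f : ι → MvPolynomial (Fin 3) K} {δ : ι → ℕ} (hf : ∀ j, (f j).IsHomogeneous (δ j))
    (h0 : ∀ v, (∀ j, eval v (f j) = 0) → v = 0) :
    ∃ n, (∀ j, δ j ≤ n) ∧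
      ∀ a : (Finset.univ : Finset (Fin 3)).finsuppAntidiag n,
        ∃ u : ι → MvPolynomial (Fin 3) K, (∀ j, (u j).IsHomogeneous (n - δ j)) ∧
          ∑ j, u j * f j = monomial (a : Fin 3 →₀ ℕ) 1 := by
  obtain ⟨N, hN⟩ := exists_forall_X_pow_mem_span (s := Set.range f)
    fun v hv => h0 v fun j => hv _ ⟨j, rfl⟩
  have hδ : ∀ j, δ j ≤ 3 * N + ∑ j, δ j := fun j =>
    (Finset.single_le_sum (fun _ _ => Nat.zero_le _) (Finset.mem_univ j)).trans
      (Nat.le_add_left _ _)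
  -- The term `3 * N` forces some exponent to be at least `N`; the sum makes the degree at least
  -- every `δ j`.
  refine ⟨3 * N + ∑ j, δ j, hδ, fun a => ?_⟩
  have ha := mem_finsuppAntidiag_univ_iff.1 a.2
  obtain ⟨i, hi⟩ : ∃ i, N ≤ (a : Fin 3 →₀ ℕ) i := by
    by_contra! h
    rw [Finsupp.degree_eq_sum, Fin.sum_univ_three] at ha
    have := h 0
    have := h 1
    have := h 2
    omega
  have hmem : monomial (a : Fin 3 →₀ ℕ) (1 : K) ∈ Ideal.span (Set.range f) := by
    have hdvd : (X i ^ N : MvPolynomial (Fin 3) K) ∣ monomial (a : Fin 3 →₀ ℕ) 1 := by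
      rw [X_pow_eq_monomial]
      refine ⟨monomial ((a : Fin 3 →₀ ℕ) - Finsupp.single i N) 1, ?_⟩
      rw [monomial_mul, one_mul, add_tsub_cancel_of_le (Finsupp.single_le_iff.2 hi)]
    exact Ideal.mem_of_dvd _ hdvd (hN i)
  obtain ⟨c, hc⟩ := Ideal.mem_span_range_iff_exists_fun.1 hmem
  refine ⟨fun j => homogeneousComponent (3 * N + ∑ j, δ j - δ j) (c j),
    fun j => homogeneousComponent_isHomogeneous _ _, ?_⟩
  rw [← homogeneousComponent_eq_self (isHomogeneous_monomial 1 ha), ← hc, map_sum]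
  refine Finset.sum_congr rfl fun j _ => ?_
  rw [mul_comm (c j), homogeneousComponent_mul_of_le (hf j) (hδ j), mul_comm]

/-- Keep the coefficients `u` that express all monomials of degree `n` through the forms at `B₀`,
and let `B` vary. The resulting matrix is the identity at `B₀`, and its determinant is the required
polynomial. -/
theorem exists_polynomial_of_no_zeros [IsAlgClosed K] {ι : Type*} [Fintype ι]
    {F : ι → MvPolynomial (Fin 3) K → MvPolynomial (Fin 3) K} {δ : ι → ℕ} {d : ℕ}
    (hF : ∀ j B, B.IsHomogeneous d → (F j B).IsHomogeneous (δ j))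
    (hpoly : ∀ j, DependsPolynomially (F j)) {B₀ : MvPolynomial (Fin 3) K}
    (hB₀ : B₀.IsHomogeneous d) (h0 : ∀ v, (∀ j, eval v (F j B₀) = 0) → v = 0) :
    ∃ P : MvPolynomial (Fin 3 →₀ ℕ) K, eval (fun m => coeff m B₀) P ≠ 0 ∧
      ∀ B : MvPolynomial (Fin 3) K, B.IsHomogeneous d → eval (fun m => coeff m B) P ≠ 0 →
        ∀ v, (∀ j, eval v (F j B) = 0) → v = 0 := by
  classical
  obtain ⟨n, hn, hu⟩ := exists_monomial_combination (fun j => hF j B₀ hB₀) h0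
  choose u hu hum using hu
  choose Q hQ using hpoly
  let G : Matrix ((Finset.univ : Finset (Fin 3)).finsuppAntidiag n)
      ((Finset.univ : Finset (Fin 3)).finsuppAntidiag n) (MvPolynomial (Fin 3 →₀ ℕ) K) :=
    Matrix.of fun a b => ∑ j, ∑ x ∈ Finset.HasAntidiagonal.antidiagonal (b : Fin 3 →₀ ℕ),
      C (coeff x.1 (u a j)) * Q j x.2
  have hG : ∀ B, eval (fun m => coeff m B) G.det = (Matrix.of fun a b :
      (Finset.univ : Finset (Fin 3)).finsuppAntidiag n =>
        coeff b (∑ j, u a j * F j B)).det := fun B => by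
    rw [RingHom.map_det]
    congr 1
    ext a b
    simp only [G, RingHom.mapMatrix_apply, Matrix.map_apply, Matrix.of_apply, map_sum, map_mul,
      eval_C, coeff_sum, coeff_mul, hQ]
  refine ⟨G.det, ?_, fun B hB hdet v hv => ?_⟩
  · rw [hG]
    have : (Matrix.of fun a b : (Finset.univ : Finset (Fin 3)).finsuppAntidiag n =>
        coeff b (∑ j, u a j * F j B₀)) = 1 := by
      ext a b
      rw [Matrix.of_apply, hum, coeff_monomial, Matrix.one_apply]
      simp only [Subtype.ext_iff]
    rw [this, Matrix.det_one]
    exact one_ne_zero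
  · rw [hG] at hdet
    refine eq_zero_of_det_ne_zero (fun a => ?_) hdet hv
    refine IsHomogeneous.sum _ _ _ fun j _ => ?_
    have := (hu a j).mul (hF j B hB)
    rwa [Nat.sub_add_cancel (hn j)] at this

end Open

/-! ### A curve with reduced critical scheme and no singular points -/

section Example

variable (K : Type*) [Field K]

/-- The form `x ^ (c + 1) * y + y ^ (c + 1) * z + z ^ (c + 1) * x`. -/
def cyclicForm (c : ℕ) : MvPolynomial (Fin 3) K :=
  X 0 ^ (c + 1) * X 1 + X 1 ^ (c + 1) * X 2 + X 2 ^ (c + 1) * X 0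

theorem cyclicForm_isHomogeneous (c : ℕ) : (cyclicForm K c).IsHomogeneous (c + 2) := by
  have h : ∀ i j : Fin 3, (X i ^ (c + 1) * X j : MvPolynomial (Fin 3) K).IsHomogeneous (c + 2) :=
    fun i j => (isHomogeneous_X_pow i (c + 1)).mul (isHomogeneous_X K j)
  exact ((h 0 1).add (h 1 2)).add (h 2 0)

variable [CharP K 2] {c : ℕ}

theorem pderiv_cyclicForm (hc : Even c) (i : Fin 3) : pderiv i (cyclicForm K c) =
    X i ^ c * X (i + 1) + X (i + 2) ^ (c + 1) := by
  have h1 : (c + 1 : MvPolynomial (Fin 3) K) = 1 := by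
    obtain ⟨k, rfl⟩ := hc
    push_cast
    linear_combination (k : MvPolynomial (Fin 3) K) * two_eq_zero_mvPolynomial (K := K)
  fin_cases i <;> simp [cyclicForm, h1, add_comm, mul_comm]

theorem mixedPartials_cyclicForm (hc : Even c) : mixedPartials (cyclicForm K c) =
    ![X 1 ^ c, X 2 ^ c, X 0 ^ c] := by
  have h1 : (c + 1 : MvPolynomial (Fin 3) K) = 1 := by
    obtain ⟨k, rfl⟩ := hc
    push_cast
    linear_combination (k : MvPolynomial (Fin 3) K) * two_eq_zero_mvPolynomial (K := K)
  funext i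
  fin_cases i <;> simp [mixedPartials, pderiv_cyclicForm K hc, h1]

theorem eq_zero_of_gradient_cyclicForm (hc : Even c) {v : Fin 3 → K}
    (hB : eval v (cyclicForm K c) = 0) (hv : ∀ i, eval v (pderiv i (cyclicForm K c)) = 0) :
    v = 0 := by
  have e0 := hv 0
  have e1 := hv 1
  have e2 := hv 2
  simp only [pderiv_cyclicForm K hc, map_add, map_mul, map_pow, eval_X, zero_add,
    Fin.reduceAdd] at e0 e1 e2
  simp only [cyclicForm, map_add, map_mul, map_pow, eval_X] at hB
  -- Subtracting `x` times the first partial from the form leaves `y ^ (c + 1) * z`.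
  have h12 : v 1 ^ (c + 1) * v 2 = 0 := by linear_combination hB - v 0 * e0
  have key : v 1 = 0 ∨ v 2 = 0 :=
    (mul_eq_zero.1 h12).imp_left eq_zero_of_pow_eq_zero
  have h1 : v 1 = 0 := by
    rcases key with h | h
    · exact h
    · have h0 : v 0 = 0 := by
        rw [h, mul_zero, zero_add] at e1
        exact eq_zero_of_pow_eq_zero e1
      rw [h0, mul_zero, zero_add] at e2
      exact eq_zero_of_pow_eq_zero e2
  have h2 : v 2 = 0 := by
    rw [h1, mul_zero, zero_add] at e0
    exact eq_zero_of_pow_eq_zero e0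
  have h0 : v 0 = 0 := by
    rw [h2, mul_zero, zero_add] at e1
    exact eq_zero_of_pow_eq_zero e1
  funext i
  fin_cases i <;> assumption

theorem eq_zero_of_mixedPartials_cyclicForm (hc : Even c) {v : Fin 3 → K}
    (hv : ∀ i, eval v (mixedPartials (cyclicForm K c) i) = 0) : v = 0 := by
  simp only [mixedPartials_cyclicForm K hc] at hv
  have e0 := hv 0
  have e1 := hv 1
  have e2 := hv 2
  simp only [Matrix.cons_val, map_pow, eval_X] at e0 e1 e2
  funext i
  fin_cases i
  exacts [eq_zero_of_pow_eq_zero e2, eq_zero_of_pow_eq_zero e0, eq_zero_of_pow_eq_zero e1]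

theorem eq_zero_of_gradient_cyclicForm_of_chartForm (hc : Even c) {v : Fin 3 → K}
    (hl : eval v (chartForm (0 : K) 0) = 0)
    (hv : ∀ i, eval v (pderiv i (cyclicForm K c)) = 0) : v = 0 := by
  have h2 : v 2 = 0 := by simpa [chartForm] using hl
  refine eq_zero_of_gradient_cyclicForm K hc ?_ hv
  have e1 := hv 1
  simp only [pderiv_cyclicForm K hc, map_add, map_mul, map_pow, eval_X, Fin.reduceAdd, h2,
    mul_zero, zero_add] at e1
  simp only [cyclicForm, map_add, map_mul, map_pow, eval_X, h2, e1]
  simp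

end Example

/-- The product of the three determinants, each nonzero at `cyclicForm K c`, defines the open set.
The index `none` stands for `B` itself in the first condition and for the line `z = 0` in the third.
-/
theorem holdsForGeneral_strangePoints {K : Type*} [Field K] [IsAlgClosed K] [CharP K 2]
    {d : ℕ} (hd : Even d) (hd2 : 2 ≤ d) :
    HoldsForGeneral (K := K) d fun B => strangePoints B = criticalLocus B ∧
      (criticalLocus B).Finite ∧ (criticalLocus B).ncard = (d - 1) * (d - 2) + 1 := by
  obtain ⟨c, rfl⟩ := Nat.exists_eq_add_of_le' hd2
  have hc : Even c := (Nat.even_add.1 hd).2 even_two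
  have hB₀ := cyclicForm_isHomogeneous K c
  obtain ⟨P₁, hP₁, h₁⟩ := exists_polynomial_of_no_zeros (d := c + 2)
    (F := fun (j : Option (Fin 3)) (B : MvPolynomial (Fin 3) K) => j.elim B (pderiv · B))
    (δ := fun j => j.elim (c + 2) fun _ => c + 1)
    (by rintro (_ | j) B hB; exacts [hB, pderiv_isHomogeneous hB j])
    (by rintro (_ | j); exacts [dependsPolynomially_id, dependsPolynomially_id.pderiv j])
    hB₀ (fun v hv => eq_zero_of_gradient_cyclicForm K hc (hv none) fun i => hv (some i))
  obtain ⟨P₂, hP₂, h₂⟩ := exists_polynomial_of_no_zeros (d := c + 2)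
    (F := fun (j : Fin 3) (B : MvPolynomial (Fin 3) K) => mixedPartials B j) (δ := fun _ => c)
    (fun j B hB => mixedPartials_isHomogeneous hB j)
    (fun j => by
      have h : ∀ i j, DependsPolynomially fun B : MvPolynomial (Fin 3) K =>
        pderiv i (pderiv j B) := fun i j => (dependsPolynomially_id.pderiv j).pderiv i
      fin_cases j
      exacts [h 1 2, h 0 2, h 0 1])
    hB₀ (fun v hv => eq_zero_of_mixedPartials_cyclicForm K hc hv)
  obtain ⟨P₃, hP₃, h₃⟩ := exists_polynomial_of_no_zeros (d := c + 2)
    (F := fun (j : Option (Fin 3)) (B : MvPolynomial (Fin 3) K) =>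
      j.elim (chartForm 0 0) (pderiv · B))
    (δ := fun j => j.elim 1 fun _ => c + 1)
    (by rintro (_ | j) B hB; exacts [chartForm_isHomogeneous 0 0, pderiv_isHomogeneous hB j])
    (by rintro (_ | j); exacts [dependsPolynomially_const _, dependsPolynomially_id.pderiv j])
    hB₀ (fun v hv => eq_zero_of_gradient_cyclicForm_of_chartForm K hc (hv none)
      fun i => hv (some i))
  refine ⟨P₁ * P₂ * P₃, ⟨cyclicForm K c, hB₀, ?_⟩, fun B hB hP => ?_⟩
  · rw [map_mul, map_mul]
    exact mul_ne_zero (mul_ne_zero hP₁ hP₂) hP₃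
  · rw [map_mul, map_mul, mul_ne_zero_iff, mul_ne_zero_iff] at hP
    refine ⟨Set.Subset.antisymm (fun p hp => hp.1) fun p hp => ⟨hp, fun h => ?_⟩, ?_⟩
    · exact p.rep_nonzero (h₁ B hB hP.1.1 _ (Option.rec h hp))
    · exact ncard_criticalLocus (α := 0) (β := 0) hd hd2 hB (h₂ B hB hP.1.2)
        fun v hv hl => h₃ B hB hP.2 v (Option.rec hl hv)

end StrangePoints

end

theorem mainTheorem10 {K : Type*} [Field K] [IsAlgClosed K] [CharP K 2]
    (d : ℕ) (hd : Even d) (hd2 : 2 ≤ d) :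
    StrangePoints.HoldsForGeneral (K := K) d (fun B =>
        StrangePoints.strangePoints B = StrangePoints.criticalLocus B ∧
        (StrangePoints.criticalLocus B).Finite ∧
        (StrangePoints.criticalLocus B).ncard = (d - 1) * (d - 2) + 1) ∧
    ∀ B : MvPolynomial (Fin 3) K, B.IsHomogeneous d →
      (StrangePoints.criticalLocus B).Finite →
      StrangePoints.criticalLength B = (((d - 1) * (d - 2) + 1 : ℕ) : ℕ∞) := by
  refine ⟨StrangePoints.holdsForGeneral_strangePoints hd hd2, fun B hB hfin => ?_⟩
  obtain ⟨c, rfl⟩ := Nat.exists_eq_add_of_le' hd2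
  exact StrangePoints.criticalLength_eq hd hB hfin
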